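/- Let $(G_i)_{i\in I}$ be a family of finite groups, indexed by an arbitrary set $I$, and let \[ G=\bigoplus_{i\in I}G_i=\Bigl\{(x_i)_{i\in I}\in\prod_{i\in I}G_i : x_i=e_{G_i}\text{ for all but finitely many } i\Bigr\} \] be its restricted direct product, regarded as a discrete group. Let $\mathrm{Z}\ell^1(G)$ be the centre of the convolution algebra $\ell^1(G)$ of absolutely summable functions $G\to\mathbb{C}$; it is a commutative unital Banach algebra in the $\ell^1$-norm. A bounded approximate identity (of norm $\le M$) for an ideal $J$ of $\mathrm{Z}\ell^1(G)$ is a norm-bounded net $(e_\alpha)$ in $J$ (with $\|e_\alpha\|_1\le M$ for all $\alpha$) such that $\|e_\alpha * f-f\|_1\to 0$ for every $f\in J$. (a) If every maximal ideal of $\mathrm{Z}\ell^1(G)$ has a bounded approximate identity, then all but finitely many of the groups $G_i$ are nilpotent. (b) If all but finitely many of the groups $G_i$ are nilpotent of class at most $2$, then there is a constant $M>0$ such that every maximal ideal of $\mathrm{Z}\ell^1(G)$ has a bounded approximate identity of norm $\le M$. -/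

import Mathlib

open Filter Topology
open scoped RestrictedProduct

universe u v

/-- The underlying Banach space of the group algebra `ℓ¹(G)` of a discrete group `G`: absolutely
summable functions `f : G → ℂ`, with `‖f‖ = ∑ x, |f x|`. -/
def L1 (G : Type u) : Type u := lp (fun _ : G => ℂ) 1

namespace L1

section Space

variable {G : Type u}

noncomputable instance : NormedAddCommGroup (L1 G) :=
  inferInstanceAs (NormedAddCommGroup (lp (fun _ : G => ℂ) 1))

noncomputable instance : NormedSpace ℂ (L1 G) :=
  inferInstanceAs (NormedSpace ℂ (lp (fun _ : G => ℂ) 1))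

instance : CompleteSpace (L1 G) :=
  inferInstanceAs (CompleteSpace (lp (fun _ : G => ℂ) 1))

instance : FunLike (L1 G) G ℂ where
  coe f := f.1
  coe_injective _ _ h := Subtype.ext h

@[ext] theorem ext {f g : L1 G} (h : ∀ x, f x = g x) : f = g :=
  DFunLike.ext f g h

@[simp] theorem add_apply (f g : L1 G) (x : G) : (f + g) x = f x + g x := rfl

@[simp] theorem zero_apply (x : G) : (0 : L1 G) x = 0 := rfl

@[simp] theorem smul_apply (c : ℂ) (f : L1 G) (x : G) : (c • f) x = c * f x := rfl

theorem summable_norm (f : L1 G) : Summable fun x => ‖f x‖ := by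
  have h : Memℓp f.1 1 := f.2
  have h' := (memℓp_gen_iff (by simp)).1 h
  simp only [ENNReal.toReal_one, Real.rpow_one] at h'
  exact h'

theorem norm_eq (f : L1 G) : ‖f‖ = ∑' x, ‖f x‖ := by
  have h := lp.norm_eq_tsum_rpow (p := 1) (by simp) (show lp (fun _ : G => ℂ) 1 from f)
  simp only [ENNReal.toReal_one, Real.rpow_one, div_one] at h
  exact h

/-- An absolutely summable function, as an element of `ℓ¹(G)`. -/
def mk (f : G → ℂ) (hf : Summable fun x => ‖f x‖) : L1 G :=
  ⟨f, memℓp_gen (by simpa using hf)⟩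

@[simp] theorem mk_apply (f : G → ℂ) (hf : Summable fun x => ‖f x‖) (x : G) :
    mk f hf x = f x := rfl

theorem norm_apply_le (f : L1 G) (x : G) : ‖f x‖ ≤ ‖f‖ := by
  rw [norm_eq]
  exact f.summable_norm.le_tsum x fun _ _ => norm_nonneg _

end Space

section Algebra

variable {G : Type u} [Group G]

/-- The bijection `(y, z) ↦ (y, y * z)`. -/
def shear (G : Type u) [Group G] : G × G ≃ G × G where
  toFun p := (p.1, p.1 * p.2)
  invFun p := (p.1, p.1⁻¹ * p.2)
  left_inv p := by simp
  right_inv p := by simp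

theorem summable_conv_norm (f g : L1 G) :
    Summable fun p : G × G => ‖f p.1 * g (p.1⁻¹ * p.2)‖ := by
  have h : Summable fun p : G × G => ‖f p.1‖ * ‖g p.2‖ :=
    f.summable_norm.mul_of_nonneg g.summable_norm (fun _ => norm_nonneg _) fun _ => norm_nonneg _
  rw [← (shear G).summable_iff]
  refine h.congr fun p => ?_
  simp [shear]

theorem tsum_conv_norm (f g : L1 G) :
    ∑' p : G × G, ‖f p.1 * g (p.1⁻¹ * p.2)‖ = ‖f‖ * ‖g‖ := by
  have h : Summable fun p : G × G => ‖f p.1‖ * ‖g p.2‖ :=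
    f.summable_norm.mul_of_nonneg g.summable_norm (fun _ => norm_nonneg _) fun _ => norm_nonneg _
  rw [← (shear G).tsum_eq, norm_eq, norm_eq, f.summable_norm.tsum_mul_tsum g.summable_norm h]
  refine tsum_congr fun p => ?_
  simp [shear]

theorem summable_conv_norm_swap (f g : L1 G) :
    Summable fun p : G × G => ‖f p.2 * g (p.2⁻¹ * p.1)‖ :=
  (Equiv.prodComm G G).summable_iff.2 (summable_conv_norm f g)

theorem summable_conv_apply_norm (f g : L1 G) (x : G) :
    Summable fun y => ‖f y * g (y⁻¹ * x)‖ :=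
  (summable_conv_norm_swap f g).prod_factor x

theorem summable_conv_apply (f g : L1 G) (x : G) :
    Summable fun y => f y * g (y⁻¹ * x) :=
  (summable_conv_apply_norm f g x).of_norm

theorem norm_conv_apply_le (f g : L1 G) (x : G) :
    ‖∑' y, f y * g (y⁻¹ * x)‖ ≤ ∑' y, ‖f y * g (y⁻¹ * x)‖ :=
  norm_tsum_le_tsum_norm (summable_conv_apply_norm f g x)

theorem summable_conv (f g : L1 G) : Summable fun x => ‖∑' y, f y * g (y⁻¹ * x)‖ :=
  Summable.of_nonneg_of_le (fun _ => norm_nonneg _) (norm_conv_apply_le f g)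
    (summable_conv_norm_swap f g).prod

/-- Multiplication in `ℓ¹(G)` is convolution, `(f * g) x = ∑ y, f y * g (y⁻¹ * x)`. -/
noncomputable instance : Mul (L1 G) :=
  ⟨fun f g => mk (fun x => ∑' y, f y * g (y⁻¹ * x)) (summable_conv f g)⟩

theorem mul_apply (f g : L1 G) (x : G) : (f * g) x = ∑' y, f y * g (y⁻¹ * x) := rfl

open scoped Classical in
/-- The unit of `ℓ¹(G)` is the point mass at the identity of `G`. -/
noncomputable instance : One (L1 G) :=
  ⟨mk (fun x => if x = 1 then 1 else 0) (summable_of_ne_finset_zero (s := {1}) fun x hx => by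
    have hx : x ≠ 1 := by simpa using hx
    simp [hx])⟩

open scoped Classical in
theorem one_apply (x : G) : (1 : L1 G) x = if x = 1 then 1 else 0 := rfl

theorem norm_mul_le' (f g : L1 G) : ‖f * g‖ ≤ ‖f‖ * ‖g‖ := by
  rw [norm_eq (f * g), ← tsum_conv_norm f g, ← (Equiv.prodComm G G).tsum_eq]
  rw [show (∑' c, (fun p : G × G => ‖f p.1 * g (p.1⁻¹ * p.2)‖) (Equiv.prodComm G G c))
      = ∑' c : G × G, ‖f c.2 * g (c.2⁻¹ * c.1)‖ from rfl, (summable_conv_norm_swap f g).tsum_prod]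
  exact (summable_conv f g).tsum_le_tsum (norm_conv_apply_le f g)
    (summable_conv_norm_swap f g).prod

theorem mul_assoc' (f g h : L1 G) : f * g * h = f * (g * h) := by
  ext x
  simp only [mul_apply]
  have key : Summable fun p : G × G => f p.1 * g (p.1⁻¹ * p.2) * h (p.2⁻¹ * x) := by
    refine Summable.of_norm_bounded ((summable_conv_norm f g).mul_right ‖h‖) fun p => ?_
    rw [norm_mul]
    exact mul_le_mul_of_nonneg_left (norm_apply_le h _) (norm_nonneg _)
  calc ∑' z, (∑' y, f y * g (y⁻¹ * z)) * h (z⁻¹ * x)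
      = ∑' z, ∑' y, f y * g (y⁻¹ * z) * h (z⁻¹ * x) := by
        simp only [tsum_mul_right]
    _ = ∑' y, ∑' z, f y * g (y⁻¹ * z) * h (z⁻¹ * x) := Summable.tsum_comm key
    _ = ∑' y, f y * ∑' w, g w * h (w⁻¹ * (y⁻¹ * x)) := by
        refine tsum_congr fun y => ?_
        rw [← tsum_mul_left, ← (Equiv.mulLeft y).tsum_eq]
        refine tsum_congr fun w => ?_
        simp [mul_assoc]

noncomputable instance : NormedRing (L1 G) where
  __ := (inferInstance : NormedAddCommGroup (L1 G))
  mul := (· * ·)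
  one := 1
  mul_assoc := mul_assoc'
  one_mul f := by
    ext x
    rw [mul_apply, tsum_eq_single 1 fun y hy => by simp [one_apply, hy]]
    simp [one_apply]
  mul_one f := by
    ext x
    rw [mul_apply, tsum_eq_single x fun y hy => by
      have : y⁻¹ * x ≠ 1 := fun h => hy (inv_mul_eq_one.1 h)
      simp [one_apply, this]]
    simp [one_apply]
  zero_mul f := by ext x; simp [mul_apply]
  mul_zero f := by ext x; simp [mul_apply]
  left_distrib f g h := by
    ext x
    simp only [mul_apply, add_apply, mul_add]
    exact (summable_conv_apply f g x).tsum_add (summable_conv_apply f h x)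
  right_distrib f g h := by
    ext x
    simp only [mul_apply, add_apply, add_mul]
    exact (summable_conv_apply f h x).tsum_add (summable_conv_apply g h x)
  norm_mul_le := norm_mul_le'

noncomputable instance : Algebra ℂ (L1 G) :=
  Algebra.ofModule
    (fun c f g => by
      ext x
      simp only [mul_apply, smul_apply, mul_assoc, tsum_mul_left])
    (fun c f g => by
      ext x
      simp only [mul_apply, smul_apply, mul_left_comm _ c, tsum_mul_left])

noncomputable instance : NormedAlgebra ℂ (L1 G) where
  norm_smul_le c f := norm_smul_le c f

end Algebra

end L1

/-- `Zℓ¹(G)`, the centre of the group algebra `ℓ¹(G)`, with the norm of `ℓ¹(G)`. -/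
abbrev ZL1 (G : Type u) [Group G] : Type u := Subalgebra.center ℂ (L1 G)

noncomputable instance ZL1.instNormedCommRing (G : Type u) [Group G] : NormedCommRing (ZL1 G) where
  __ := (inferInstance : NormedRing (Subalgebra.center ℂ (L1 G)))
  mul_comm f g := Subtype.ext ((Subalgebra.mem_center_iff.1 g.2 f.1))

/-- The ideal `J` has a bounded approximate identity of norm at most `M`: there is a net
`(e d)` in `J`, indexed by a non-empty directed set `D`, with `‖e d‖ ≤ M` for all `d`, such that
`e d * f → f` for every `f ∈ J`. -/
def Ideal.HasApproxIdentityOfNormLE {A : Type u} [NormedCommRing A] (J : Ideal A) (M : ℝ) : Prop :=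
  ∃ (D : Type u) (_ : Preorder D) (_ : IsDirectedOrder D) (_ : Nonempty D) (e : D → A),
    (∀ d, e d ∈ J) ∧ (∀ d, ‖e d‖ ≤ M) ∧ ∀ f ∈ J, Tendsto (fun d => e d * f) atTop (𝓝 f)

/-- The ideal `J` has a bounded approximate identity. -/
def Ideal.HasBoundedApproxIdentity {A : Type u} [NormedCommRing A] (J : Ideal A) : Prop :=
  ∃ M : ℝ, J.HasApproxIdentityOfNormLE M

/-- The restricted direct product of a family of groups: all families `(x i)` in the full product
with `x i = 1` for all but finitely many `i`. -/
abbrev RestrictedDirectProduct {I : Type u} (G : I → Type v) [∀ i, Group (G i)] : Type (max u v) :=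
  Πʳ i, [G i, (⊥ : Subgroup (G i))]

/-! Everything is governed by the `ℓ¹`-norms of minimal central idempotents. A character of the
centre restricts to each finite direct factor `K` as a spherical function `ω`, and with `S = ∑ |ω|²`
the element `E = conj ω / S` is a central idempotent of norm `∑ |ω| / S` at which the character is
`1`. A maximal ideal is the kernel of a character. If it has an approximate identity bounded by `M`,
all these norms are at most `M + 2` (proved here for characters that are products over the
coordinates, `sum_norm_le_mul_of_approxIdentity`); conversely, if they are bounded by `C`, the
elements `1 - E`, taken over the finite subproducts, form an approximate identity bounded by `1 +
C`.

For (a), the norm is multiplicative over finite products, so it suffices that each non-nilpotent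
finite group has an `ω` of norm at least `301/300`: infinitely many such factors give a character
with unbounded norms. Dividing out centres reduces this to a nontrivial group with trivial centre.
Take a minimal normal subgroup `N` and an `ω` with sum `0` over `N`. If the norm of its idempotent
were close to `1`, then `|ω|` would be close to an indicator function; its large values would form a
normal subgroup `H` on which `|ω| = 1` exactly, and counting would give `H ⊓ N ≠ ⊥`, hence `N ≤ H`.
Then `ω` is a linear character on `N` that kills all commutators with `N`: either its kernel in `N`
is trivial and `N` is central, or `ω = 1` on `N`. Both are impossible (`IsSpherical.gap`).

For (b), on a group of class at most two `|ω|` takes only the values `0` and `1`, so the norm is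
`1`; the finitely many exceptional factors contribute at most the product of their orders. -/

open scoped ComplexConjugate commutatorElement

/-! ### Spherical functions on a finite group -/

/-- The normalised irreducible characters `x ↦ χ x / χ 1` of a finite group `K`, characterised by
the functional equation `∑ g, ω (x g y g⁻¹) = |K| ω x ω y`. -/
structure IsSpherical {K : Type*} [Group K] [Fintype K] (ω : K → ℂ) : Prop where
  map_one : ω 1 = 1
  sum_conj : ∀ x y, ∑ g, ω (x * (g * y * g⁻¹)) = Fintype.card K * (ω x * ω y)

namespace IsSpherical

section Basic

variable {K : Type*} [Group K] [Fintype K] {ω : K → ℂ}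

theorem card_ne_zero (K : Type*) [Group K] [Fintype K] : (Fintype.card K : ℂ) ≠ 0 :=
  Nat.cast_ne_zero.2 Fintype.card_ne_zero

theorem one : IsSpherical (fun _ : K => (1 : ℂ)) := ⟨rfl, fun x y => by simp⟩

/-- At `x = 1` the functional equation exhibits `ω y` as a mean over the conjugates of `y`, and
conjugating `y` only reindexes that mean. -/
theorem conj_apply (h : IsSpherical ω) (g x : K) : ω (g * x * g⁻¹) = ω x := by
  have key : ∀ y, ∑ k, ω (k * y * k⁻¹) = Fintype.card K * ω y := fun y => by
    simpa [h.map_one] using h.sum_conj 1 y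
  refine mul_left_cancel₀ (card_ne_zero K) ?_
  rw [← key, ← key, ← Equiv.sum_comp (Equiv.mulRight g) (fun k => ω (k * x * k⁻¹))]
  exact Finset.sum_congr rfl fun k _ => by simp [mul_assoc]

theorem mul_comm_apply (h : IsSpherical ω) (x y : K) : ω (x * y) = ω (y * x) := by
  rw [← h.conj_apply y (x * y)]; simp [mul_assoc]

/-- Spherical functions are eigenvectors of convolution by class functions: `y` may be averaged over
its conjugates, after which the functional equation applies. -/
theorem sum_mul_inv_mul (h : IsSpherical ω) {a : K → ℂ} (ha : ∀ g x, a (g * x * g⁻¹) = a x)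
    (x : K) : ∑ y, a y * ω (y⁻¹ * x) = (∑ y, a y * ω y⁻¹) * ω x := by
  refine mul_left_cancel₀ (card_ne_zero K) ?_
  calc (Fintype.card K : ℂ) * ∑ y, a y * ω (y⁻¹ * x)
      = ∑ g : K, ∑ y, a y * ω (y⁻¹ * x) := by simp
    _ = ∑ g : K, ∑ y, a y * ω (x * (g * y⁻¹ * g⁻¹)) := by
        refine Finset.sum_congr rfl fun g _ => ?_
        refine (Equiv.sum_comp (MulAut.conj g).toEquiv _).symm.trans ?_
        refine Finset.sum_congr rfl fun y _ => ?_
        change a (g * y * g⁻¹) * ω ((g * y * g⁻¹)⁻¹ * x) = _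
        rw [h.mul_comm_apply x, ha]
        simp [mul_assoc]
    _ = ∑ y, a y * ∑ g, ω (x * (g * y⁻¹ * g⁻¹)) := by
        rw [Finset.sum_comm]
        simp only [Finset.mul_sum]
    _ = _ := by
        simp only [h.sum_conj, Finset.sum_mul, Finset.mul_sum]
        exact Finset.sum_congr rfl fun y _ => by ring

/-- Maximum principle: at a point `x` where `|ω|` is largest, `ω x * ω y` is a mean of values of
modulus at most `|ω x|`. -/
theorem norm_le_one (h : IsSpherical ω) (y : K) : ‖ω y‖ ≤ 1 := by
  obtain ⟨x, hx⟩ := Finite.exists_max fun x => ‖ω x‖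
  have h1 : 1 ≤ ‖ω x‖ := by simpa [h.map_one] using hx 1
  have h2 : (Fintype.card K : ℝ) * (‖ω x‖ * ‖ω y‖) ≤ Fintype.card K * ‖ω x‖ := by
    have := norm_sum_le Finset.univ fun g => ω (x * (g * y * g⁻¹))
    rw [h.sum_conj, norm_mul, norm_mul, Complex.norm_natCast] at this
    refine this.trans ((Finset.sum_le_sum fun g _ => hx _).trans ?_)
    simp
  have h3 : (0 : ℝ) < Fintype.card K := Nat.cast_pos.2 Fintype.card_pos
  have h4 := le_of_mul_le_mul_left h2 h3
  exact le_of_mul_le_mul_left (by simpa using h4) (by linarith : 0 < ‖ω x‖)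

theorem one_le_sum_sq (h : IsSpherical ω) : 1 ≤ ∑ x, ‖ω x‖ ^ 2 := by
  have := Finset.single_le_sum (f := fun x => ‖ω x‖ ^ 2) (fun x _ => by positivity)
    (Finset.mem_univ (1 : K))
  simpa [h.map_one] using this

theorem conj_inv (h : IsSpherical ω) : IsSpherical fun x => conj (ω x⁻¹) where
  map_one := by simp [h.map_one]
  sum_conj x y := by
    have := congrArg conj (h.sum_conj x⁻¹ y⁻¹)
    simp only [map_sum, map_mul, map_natCast] at this
    rw [← this]
    refine Finset.sum_congr rfl fun g _ => ?_
    rw [h.mul_comm_apply]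
    simp [mul_assoc]

/-- The adjoint `conj (ω x⁻¹)` is spherical too. Its convolution with `ω`, read through the
eigenvector property of either factor, is `∑ |ω|²` times that factor, so the two coincide. -/
theorem inv_apply (h : IsSpherical ω) (x : K) : ω x⁻¹ = conj (ω x) := by
  have h1 := h.conj_inv.sum_mul_inv_mul h.conj_apply x⁻¹
  have h2 := h.sum_mul_inv_mul (a := fun x => conj (ω x⁻¹)) h.conj_inv.conj_apply x⁻¹
  have e1 : ∑ y, ω y * conj (ω (y⁻¹ * x⁻¹)⁻¹) = ∑ y, conj (ω y⁻¹) * ω (y⁻¹ * x⁻¹) := by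
    rw [← Equiv.sum_comp ((Equiv.mulLeft x).trans (Equiv.inv K))]
    refine Finset.sum_congr rfl fun y _ => ?_
    have : ω (x * (y⁻¹ * x⁻¹)) = ω y⁻¹ := by rw [← mul_assoc, h.conj_apply]
    simp [mul_comm, this]
  have e2 : ∑ y, ω y * conj (ω y⁻¹⁻¹) = ((∑ x, ‖ω x‖ ^ 2 : ℝ) : ℂ) := by
    push_cast
    exact Finset.sum_congr rfl fun y _ => by rw [inv_inv, Complex.mul_conj']
  have e3 : ∑ y, conj (ω y⁻¹) * ω y⁻¹ = ((∑ x, ‖ω x‖ ^ 2 : ℝ) : ℂ) := by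
    rw [← Equiv.sum_comp (Equiv.inv K)]
    push_cast
    exact Finset.sum_congr rfl fun y _ => by simp [Complex.conj_mul']
  rw [e1, h2, e2, e3] at h1
  have := mul_left_cancel₀ (Complex.ofReal_ne_zero.2 (by linarith [h.one_le_sum_sq])) h1
  simpa using this

theorem comp_conj (h : IsSpherical ω) : IsSpherical fun x => conj (ω x) where
  map_one := by simp [h.map_one]
  sum_conj x y := by simpa using congrArg conj (h.sum_conj x y)

theorem norm_inv (h : IsSpherical ω) (x : K) : ‖ω x⁻¹‖ = ‖ω x‖ := by
  rw [h.inv_apply, RCLike.norm_conj]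

/-- Positive definiteness: values of `ω` are inner products of its translates, so estimates on `ω`
become Hilbert space geometry. -/
theorem sum_mul_conj (h : IsSpherical ω) (x y : K) :
    ∑ g, ω (x⁻¹ * g) * conj (ω (y⁻¹ * g)) =
      ((∑ x, ‖ω x‖ ^ 2 : ℝ) : ℂ) * ω (x⁻¹ * y) := by
  have h1 := h.sum_mul_inv_mul h.conj_apply (x⁻¹ * y)
  have e3 : ∑ y, ω y * ω y⁻¹ = ((∑ x, ‖ω x‖ ^ 2 : ℝ) : ℂ) := by
    push_cast
    exact Finset.sum_congr rfl fun y _ => by rw [h.inv_apply, Complex.mul_conj']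
  rw [← e3, ← h1]
  refine Eq.trans ?_ (Equiv.sum_comp (Equiv.mulLeft x⁻¹) _)
  refine Finset.sum_congr rfl fun g _ => ?_
  rw [← h.inv_apply]
  simp [mul_assoc]

theorem sum_norm_sub_sq (h : IsSpherical ω) (x y : K) {c : ℂ} (hc : ‖c‖ = 1) :
    ∑ g, ‖ω (x⁻¹ * g) - c * ω (y⁻¹ * g)‖ ^ 2 =
      2 * (∑ x, ‖ω x‖ ^ 2) * (1 - (conj c * ω (x⁻¹ * y)).re) := by
  have e : ∀ z, ∑ g, ‖ω (z⁻¹ * g)‖ ^ 2 = ∑ x, ‖ω x‖ ^ 2 := fun z =>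
    Equiv.sum_comp (Equiv.mulLeft z⁻¹) fun g => ‖ω g‖ ^ 2
  have e2 := congrArg (fun z => (conj c * z).re) (h.sum_mul_conj x y)
  simp only [Finset.mul_sum, Complex.re_sum] at e2
  have e3 : ∀ g, ‖ω (x⁻¹ * g) - c * ω (y⁻¹ * g)‖ ^ 2 = ‖ω (x⁻¹ * g)‖ ^ 2 + ‖ω (y⁻¹ * g)‖ ^ 2 -
      2 * (conj c *
        (ω (x⁻¹ * g) * conj (ω (y⁻¹ * g)))).re := fun g => by
    rw [Complex.sq_norm, Complex.normSq_sub, ← Complex.sq_norm, ← Complex.sq_norm, norm_mul, hc, one_mul, map_mul]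
    congr 3
    ring
  simp only [e3, Finset.sum_sub_distrib, Finset.sum_add_distrib, e, ← Finset.mul_sum, e2]
  rw [mul_left_comm, Complex.re_ofReal_mul]
  ring

theorem exists_phase (z : ℂ) : ∃ c : ℂ, ‖c‖ = 1 ∧ (conj c * z).re = ‖z‖ := by
  by_cases hz : z = 0
  · exact ⟨1, by simp, by simp [hz]⟩
  · have hn : (‖z‖ : ℂ) ≠ 0 := by simpa using hz
    refine ⟨z / ‖z‖, by simp [hz], ?_⟩
    have : conj (z / ‖z‖) * z = ‖z‖ := by
      rw [map_div₀, Complex.conj_ofReal, div_mul_eq_mul_div, Complex.conj_mul', sq,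
        mul_div_assoc, div_self hn, mul_one]
    rw [this, Complex.ofReal_re]

/-- With optimal phases, the squared distance between `ω` and its translate by `x` is `2 S (1 - |ω
x|)`. The bound is the triangle inequality along `1`, `x`, `x * y`, squared by `(a + b)² ≤ 2a² +
2b²`. -/
theorem one_sub_norm_mul_le (h : IsSpherical ω) (x y : K) :
    1 - ‖ω (x * y)‖ ≤ 2 * (1 - ‖ω x‖) + 2 * (1 - ‖ω y‖) := by
  obtain ⟨c, hc, hcx⟩ := exists_phase (ω x)
  obtain ⟨d, hd, hdy⟩ := exists_phase (ω y)
  set S := ∑ x, ‖ω x‖ ^ 2 with hS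
  have hS1 : 1 ≤ S := h.one_le_sum_sq
  have h1 := h.sum_norm_sub_sq 1 x hc
  have h2 := h.sum_norm_sub_sq x (x * y) hd
  have h3 := h.sum_norm_sub_sq 1 (x * y) (c := c * d) (by simp [hc, hd])
  rw [← hS] at h1 h2 h3
  simp only [inv_one, one_mul, inv_mul_cancel_left] at h1 h2 h3
  rw [hcx] at h1
  rw [hdy] at h2
  have h4 : (conj (c * d) * ω (x * y)).re ≤ ‖ω (x * y)‖ := by
    refine (Complex.re_le_norm _).trans ?_
    simp [hc, hd]
  have h5 : ∀ g, ‖ω g - c * d * ω ((x * y)⁻¹ * g)‖ ^ 2 ≤ 2 * ‖ω g - c * ω (x⁻¹ * g)‖ ^ 2 +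
      2 * ‖ω (x⁻¹ * g) - d * ω ((x * y)⁻¹ * g)‖ ^ 2 := fun g => by
    have e : ω g - c * d * ω ((x * y)⁻¹ * g) = (ω g - c * ω (x⁻¹ * g)) +
      c * (ω (x⁻¹ * g) - d * ω ((x * y)⁻¹ * g)) := by ring
    have e2 := norm_add_le (ω g - c * ω (x⁻¹ * g)) (c * (ω (x⁻¹ * g) - d * ω ((x * y)⁻¹ * g)))
    rw [← e, norm_mul, hc, one_mul] at e2
    have := sq_nonneg (‖ω g - c * ω (x⁻¹ * g)‖ - ‖ω (x⁻¹ * g) - d * ω ((x * y)⁻¹ * g)‖)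
    have e3 := pow_le_pow_left₀ (norm_nonneg _) e2 2
    linarith
  have h6 := Finset.sum_le_sum fun g (_ : g ∈ Finset.univ) => h5 g
  rw [Finset.sum_add_distrib, ← Finset.mul_sum, ← Finset.mul_sum, h1, h2, h3] at h6
  have h7 : S * (1 - ‖ω (x * y)‖) ≤ S * (1 - (conj (c * d) * ω (x * y)).re) :=
    mul_le_mul_of_nonneg_left (by linarith) (by linarith)
  refine le_of_mul_le_mul_left (a := S) ?_ (by linarith)
  linarith

/-- The equality case: the translate of `ω` by `n` is at distance zero from a phase times `ω`. -/
theorem mul_apply_of_norm_eq_one (h : IsSpherical ω) {n : K} (hn : ‖ω n‖ = 1) (x : K) :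
    ω (n * x) = ω n * ω x := by
  obtain ⟨c, hc, hcx⟩ := exists_phase (ω n)
  have h1 := h.sum_norm_sub_sq n⁻¹ 1 hc
  simp only [inv_inv, inv_one, one_mul, mul_one, hcx, hn, sub_self, mul_zero] at h1
  have h2 : ∀ g, ω (n * g) = c * ω g := fun g => by
    have := (Finset.sum_eq_zero_iff_of_nonneg fun g _ => by positivity).1 h1 g (Finset.mem_univ g)
    simpa [sub_eq_zero] using this
  have h3 := h2 1
  rw [mul_one, h.map_one, mul_one] at h3
  rw [h2, h3]

end Basic

end IsSpherical

/-! ### Idempotents of norm near `1`, and the gap -/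

namespace IsSpherical

section Subgroups

variable {K : Type*} [Group K] [Fintype K] {ω : K → ℂ}

open scoped Classical in
theorem sum_normal (h : IsSpherical ω) (H : Subgroup K) [H.Normal] (x : K) :
    ∑ y : H, ω y * ω ((y : K)⁻¹ * x) = ((∑ y : H, ‖ω y‖ ^ 2 : ℝ) : ℂ) * ω x := by
  have h1 := h.sum_mul_inv_mul (a := fun y => if y ∈ H then ω y else 0) (fun g x => by
    have : g * x * g⁻¹ ∈ H ↔ x ∈ H := (Subgroup.Normal.mem_comm_iff ‹_›).trans (by simp)
    simp only [this, h.conj_apply]) x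
  simp only [ite_mul, zero_mul] at h1
  rw [← Finset.sum_filter, ← Finset.sum_filter, Finset.sum_subtype (p := (· ∈ H)) _ (by simp),
    Finset.sum_subtype (p := (· ∈ H)) _ (by simp)] at h1
  rw [h1]
  push_cast
  congr 1
  exact Finset.sum_congr rfl fun y _ => by rw [h.inv_apply, Complex.mul_conj']

open scoped Classical in
/-- If the mean of `|ω|²` over a normal subgroup exceeds `1/2`, then `|ω| = 1` there. -/
theorem norm_eq_one_of_normal (h : IsSpherical ω) (H : Subgroup K) [H.Normal]
    (hH : (Fintype.card H : ℝ) < 2 * ∑ y : H, ‖ω y‖ ^ 2) (x : H) : ‖ω x‖ = 1 := by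
  set s := ∑ y : H, ‖ω y‖ ^ 2 with hs
  have hc : (0 : ℝ) < Fintype.card H := Nat.cast_pos.2 Fintype.card_pos
  have hs0 : 0 < s := by linarith
  have hs0' : (s : ℂ) ≠ 0 := by exact_mod_cast hs0.ne'
  -- Convolution by `ω / s` on `H` is a projection, so its trace `|H| / s` is an integer rank; being
  -- less than `2` and nonzero it is `1`, so `s = |H|` and every `|ω|²` on `H` attains its bound
  -- `1`.
  let P : Matrix H H ℂ := Matrix.of fun x m => ω (x * (m : K)⁻¹) / s
  have hP : IsIdempotentElem P := by
    ext x z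
    simp only [P, Matrix.mul_apply, Matrix.of_apply]
    rw [← Equiv.sum_comp ((Equiv.inv H).trans (Equiv.mulRight x))]
    have := h.sum_normal H (x * (z : K)⁻¹)
    rw [← hs] at this
    rw [eq_div_iff hs0', ← mul_right_inj' hs0', ← this, Finset.sum_mul, Finset.mul_sum]
    refine Finset.sum_congr rfl fun y _ => ?_
    simp only [Equiv.trans_apply, Equiv.inv_apply, Equiv.coe_mulRight, Subgroup.coe_mul,
      InvMemClass.coe_inv, mul_inv_rev, inv_inv, mul_inv_cancel_left, mul_assoc]
    field_simp
  have htr : P.trace = Fintype.card H / s := by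
    simp [P, Matrix.trace, h.map_one, div_eq_mul_inv]
  have hP' : IsIdempotentElem (Matrix.toLin' P) := by
    rw [IsIdempotentElem, Module.End.mul_eq_comp, ← Matrix.toLin'_mul, hP]
  have h2 := (LinearMap.IsIdempotentElem.isProj_range _ hP').trace
  rw [Matrix.trace_toLin'_eq, htr] at h2
  set r := Module.finrank ℂ (LinearMap.range (Matrix.toLin' P))
  have h3 : (Fintype.card H : ℝ) = r * s := by
    rw [div_eq_iff hs0'] at h2
    exact_mod_cast h2
  have hle : ∀ y : H, ‖ω y‖ ^ 2 ≤ 1 := fun y => pow_le_one₀ (norm_nonneg _) (h.norm_le_one y)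
  have hr : r = 1 := by
    have h4 : (r : ℝ) < 2 := by
      by_contra hcon
      nlinarith
    have h5 : r ≠ 0 := by
      rintro h0
      rw [h0] at h3
      simp at h3
    have : r < 2 := by exact_mod_cast h4
    omega
  rw [hr, Nat.cast_one, one_mul] at h3
  have h6 : ∑ y : H, (1 - ‖ω y‖ ^ 2) = 0 := by
    simp [h3, hs]
  have h7 := (Finset.sum_eq_zero_iff_of_nonneg fun y _ => by linarith [hle y]).1 h6 x
    (Finset.mem_univ x)
  have h8 : ‖ω x‖ ^ 2 = 1 := by linarith
  nlinarith [norm_nonneg (ω x), h.norm_le_one x]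

open scoped Classical in
/-- If the idempotent of `ω` has `ℓ¹`-norm close to `1`, then `|ω| = 1` on a large normal subgroup,
off which `|ω|` is bounded away from `1`. -/
theorem exists_normal_of_sum_lt (h : IsSpherical ω)
    (hlt : ∑ x, ‖ω x‖ < 301 / 300 * ∑ x, ‖ω x‖ ^ 2) :
    ∃ H : Subgroup K, H.Normal ∧ (∀ x ∈ H, ‖ω x‖ = 1) ∧ (∀ x, x ∉ H → ‖ω x‖ < 24 / 25) ∧
      2 / 3 * ∑ x, ‖ω x‖ ^ 2 ≤ Nat.card H := by
  set S := ∑ x, ‖ω x‖ ^ 2 with hS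
  have hS1 : 1 ≤ S := h.one_le_sum_sq
  have hle := h.norm_le_one
  have hnn : ∀ x, 0 ≤ ‖ω x‖ := fun x => norm_nonneg _
  have hdef : ∑ x, ‖ω x‖ * (1 - ‖ω x‖) < 1 / 300 * S := by
    have : ∑ x, ‖ω x‖ * (1 - ‖ω x‖) = ∑ x, ‖ω x‖ - S := by
      rw [hS, ← Finset.sum_sub_distrib]
      exact Finset.sum_congr rfl fun x _ => by ring
    linarith
  have hdn : ∀ x, 0 ≤ ‖ω x‖ * (1 - ‖ω x‖) := fun x =>
    mul_nonneg (hnn x) (by linarith [hle x])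
  let A : ℝ → Finset K := fun r => Finset.univ.filter fun x => 1 - r ≤ ‖ω x‖
  have hA : ∀ r x, x ∈ A r ↔ 1 - r ≤ ‖ω x‖ := fun r x => by simp [A]
  -- size estimates for the level sets
  have hlow : 2 / 3 * S ≤ (A (1 / 100)).card := by
    -- Where `|ω| < 99/100`, the factor `100 * (1 - |ω|)` exceeds `1`. Summed, the last term is at
    -- most `100 * S / 300 = S / 3`, which leaves `2S / 3` for the level set.
    have h1 : ∀ x, ‖ω x‖ ^ 2 ≤ (if x ∈ A (1 / 100) then 1 else 0) +
        100 * (‖ω x‖ * (1 - ‖ω x‖)) := fun x => by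
      split_ifs with hx
      · nlinarith [hle x, hnn x, hdn x]
      · rw [hA, not_le] at hx
        nlinarith [hle x, hnn x]
    have h2 := Finset.sum_le_sum fun x (_ : x ∈ Finset.univ) => h1 x
    rw [Finset.sum_add_distrib, ← Finset.mul_sum, Finset.sum_ite_mem, Finset.univ_inter,
      Finset.sum_const, nsmul_eq_mul, mul_one, ← hS] at h2
    linarith
  have hup : (A (1 / 10)).card * (81 / 100 : ℝ) ≤ S := by
    rw [hS, ← nsmul_eq_mul, ← Finset.sum_const]
    refine (Finset.sum_le_sum fun x hx => ?_).trans
      (Finset.sum_le_sum_of_subset_of_nonneg (Finset.subset_univ (A (1 / 10)))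
        fun x _ _ => by positivity)
    rw [hA] at hx
    nlinarith [hnn x]
  have hinv : ∀ {r x}, x ∈ A r → x⁻¹ ∈ A r := fun {r x} hx => by
    rw [hA, h.norm_inv, ← hA]; exact hx
  have hmul : ∀ {r s x y}, x ∈ A r → y ∈ A s → x * y ∈ A (2 * r + 2 * s) := fun {r s x y} hx hy => by
    rw [hA] at *
    linarith [h.one_sub_norm_mul_le x y]
  have hmono : ∀ {r s}, r ≤ s → A r ⊆ A s := fun {r s} hrs x hx => by
    rw [hA] at *
    linarith
  -- the level set is a subgroup
  let H : Subgroup K :=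
    { carrier := {x | x ∈ A (1 / 25)}
      one_mem' := by
        change (1 : K) ∈ A (1 / 25)
        rw [hA, h.map_one]; norm_num
      inv_mem' := fun hx => hinv hx
      mul_mem' := fun {a b} ha hb => by
        change a * b ∈ A (1 / 25)
        have ha' : a⁻¹ ∈ A (1 / 25) := hinv ha
        -- Translates of `A (1/100)` by `a⁻¹` and `b` lie in `A (1/10)`, as `2/25 + 2/100 = 1/10`.
        -- Disjointness would give `4S/3 ≤ S/0.81`, so they meet. Hence `a * b` is a quotient of two
        -- elements of `A (1/100)`, and `2/100 + 2/100 = 1/25` closes the loop.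
        have e1 : ∀ c ∈ A (1 / 25), (A (1 / 100)).image (c * ·) ⊆ A (1 / 10) := fun c hc x hx => by
          obtain ⟨y, hy, rfl⟩ := Finset.mem_image.1 hx
          exact hmono (by norm_num) (hmul hc hy)
        have e2 : ∀ c : K, ((A (1 / 100)).image (c * ·)).card = (A (1 / 100)).card := fun c =>
          Finset.card_image_of_injective _ (mul_right_injective c)
        have e3 : ¬ Disjoint ((A (1 / 100)).image (a⁻¹ * ·)) ((A (1 / 100)).image (b * ·)) := by
          intro hd
          have := Finset.card_le_card (Finset.union_subset (e1 _ ha') (e1 _ hb))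
          rw [Finset.card_union_of_disjoint hd, e2, e2] at this
          have : ((A (1 / 100)).card + (A (1 / 100)).card : ℝ) ≤ (A (1 / 10)).card := by
            exact_mod_cast this
          linarith
        obtain ⟨z, hz1, hz2⟩ := Finset.not_disjoint_iff.1 e3
        obtain ⟨x, hx, rfl⟩ := Finset.mem_image.1 hz1
        obtain ⟨y, hy, hxy⟩ := Finset.mem_image.1 hz2
        have : a * b = x * y⁻¹ := by
          rw [eq_mul_inv_iff_mul_eq, mul_assoc, hxy, mul_inv_cancel_left]
        rw [this]
        exact hmono (by norm_num) (hmul hx (hinv hy)) }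
  have hHmem : ∀ x, x ∈ H ↔ 1 - 1 / 25 ≤ ‖ω x‖ := fun x => hA _ x
  have hHn : H.Normal := ⟨fun x hx g => by
    rw [hHmem, h.conj_apply, ← hHmem]; exact hx⟩
  have hH1 : ∀ x ∈ H, ‖ω x‖ = 1 := fun x hx => by
    refine h.norm_eq_one_of_normal H ?_ ⟨x, hx⟩
    have h1 : ∀ y : H, (3 / 4 : ℝ) ≤ ‖ω y‖ ^ 2 := fun y => by
      have := (hHmem y).1 y.2
      nlinarith
    have h2 := Finset.sum_le_sum fun y (_ : y ∈ Finset.univ) => h1 y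
    have hc : (0 : ℝ) < Fintype.card H := Nat.cast_pos.2 Fintype.card_pos
    simp only [Finset.sum_const, Finset.card_univ, nsmul_eq_mul] at h2
    linarith
  refine ⟨H, hHn, hH1, fun x hx => ?_, hlow.trans ?_⟩
  · rw [hHmem, not_le] at hx
    linarith
  · have e : Nat.card H = (A (1 / 25)).card := Nat.subtype_card _ fun x => Iff.rfl
    rw [e]
    exact_mod_cast Finset.card_le_card (hmono (by norm_num))

-- If the intersection were trivial, `N × H` would embed in `K` with `|ω|` depending only on the
-- `N`-coordinate. The defect `∑ |ω| (1 - |ω|) < S/300` then gives a defect below `1/200` on `N`,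
-- since `|H| ≥ 2S/3`. Off `1` this defect controls `|ω|` up to a factor `25`, so `∑ |ω|` over `N`
-- is below `2`; but cancellation of the value at `1` requires at least `2`.
open scoped Classical in
theorem exists_mem_inf_ne_one (h : IsSpherical ω) {N H : Subgroup K} [N.Normal]
    (hsum : ∑ n : N, ω n = 0) (hlt : ∑ x, ‖ω x‖ < 301 / 300 * ∑ x, ‖ω x‖ ^ 2)
    (hH1 : ∀ x ∈ H, ‖ω x‖ = 1) (hH2 : ∀ x, x ∉ H → ‖ω x‖ < 24 / 25)
    (hHcard : 2 / 3 * ∑ x, ‖ω x‖ ^ 2 ≤ Nat.card H) : H ⊓ N ≠ ⊥ := by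
  intro hbot
  set S := ∑ x, ‖ω x‖ ^ 2 with hS
  have hS1 : 1 ≤ S := h.one_le_sum_sq
  rw [Nat.card_eq_fintype_card] at hHcard
  have hle := h.norm_le_one
  have hnn : ∀ x, 0 ≤ ‖ω x‖ := fun x => norm_nonneg _
  have hdef : ∑ x, ‖ω x‖ * (1 - ‖ω x‖) < 1 / 300 * S := by
    have : ∑ x, ‖ω x‖ * (1 - ‖ω x‖) = ∑ x, ‖ω x‖ - S := by
      rw [hS, ← Finset.sum_sub_distrib]
      exact Finset.sum_congr rfl fun x _ => by ring
    linarith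
  have hdn : ∀ x, 0 ≤ ‖ω x‖ * (1 - ‖ω x‖) := fun x =>
    mul_nonneg (hnn x) (by linarith [hle x])
  have hinj : Function.Injective fun p : N × H => (p.1 : K) * p.2 := by
    rintro ⟨n, x⟩ ⟨m, y⟩ hxy
    change (n : K) * x = m * y at hxy
    have h1 : (m : K)⁻¹ * n = y * (x : K)⁻¹ := by
      rw [eq_mul_inv_iff_mul_eq, mul_assoc, hxy, inv_mul_cancel_left]
    have h2 : (m : K)⁻¹ * n ∈ H ⊓ N :=
      ⟨h1 ▸ H.mul_mem y.2 (H.inv_mem x.2), N.mul_mem (N.inv_mem m.2) n.2⟩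
    rw [hbot, Subgroup.mem_bot] at h2
    rw [h2] at h1
    have h3 := (inv_mul_eq_one.1 h2).symm
    have h4 := (mul_inv_eq_one.1 h1.symm).symm
    exact Prod.ext (Subtype.ext h3) (Subtype.ext h4)
  have hnorm : ∀ n : N, ∀ x : H, ‖ω (n * x)‖ = ‖ω n‖ := fun n x => by
    rw [h.mul_comm_apply, h.mul_apply_of_norm_eq_one (hH1 x x.2), norm_mul, hH1 x x.2, one_mul]
  have h1 : ∑ p : N × H, ‖ω (p.1 * p.2)‖ * (1 - ‖ω (p.1 * p.2)‖) ≤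
      ∑ x, ‖ω x‖ * (1 - ‖ω x‖) := by
    have e := Finset.sum_map Finset.univ (⟨_, hinj⟩ : N × H ↪ K) fun x => ‖ω x‖ * (1 - ‖ω x‖)
    refine e.symm.le.trans ?_
    exact Finset.sum_le_sum_of_subset_of_nonneg (Finset.subset_univ _) fun x _ _ => hdn x
  simp only [Fintype.sum_prod_type, hnorm, Finset.sum_const, Finset.card_univ,
    nsmul_eq_mul, ← Finset.mul_sum] at h1
  have h2 : ∀ n : N, ‖ω n‖ ≤ (if n = 1 then 1 else 0) + 25 * (‖ω n‖ * (1 - ‖ω n‖)) := fun n => by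
    split_ifs with hn
    · linarith [hle n, hdn n]
    · have : (n : K) ∉ H := fun hnH => hn (Subtype.ext (by
        have : (n : K) ∈ H ⊓ N := ⟨hnH, n.2⟩
        rw [hbot, Subgroup.mem_bot] at this
        simpa using this))
      have := hH2 n this
      nlinarith [hnn n]
  have h3 : 2 ≤ ∑ n : N, ‖ω n‖ := by
    have e1 : ∑ n ∈ Finset.univ.erase (1 : N), ω n = -1 := by
      have := Finset.sum_erase_add Finset.univ (fun n : N => ω n) (Finset.mem_univ 1)
      rw [hsum] at this
      simp only [OneMemClass.coe_one, h.map_one] at this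
      exact eq_neg_of_add_eq_zero_left this
    have e2 := norm_sum_le (Finset.univ.erase (1 : N)) fun n => ω n
    rw [e1, norm_neg, norm_one] at e2
    rw [← Finset.sum_erase_add Finset.univ (fun n : N => ‖ω n‖) (Finset.mem_univ 1)]
    simp only [OneMemClass.coe_one, h.map_one, norm_one]
    linarith
  have h4 := Finset.sum_le_sum fun n (_ : n ∈ Finset.univ) => h2 n
  rw [Finset.sum_add_distrib, ← Finset.mul_sum, Finset.sum_ite_eq' Finset.univ (1 : N)] at h4
  simp only [Finset.mem_univ, if_true] at h4
  nlinarith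

open scoped Classical in
/-- The gap lemma: if `ω` annihilates a minimal normal subgroup `N` that is not central, then the
idempotent of `ω` has `ℓ¹`-norm at least `1 + 1/300`. -/
theorem gap (h : IsSpherical ω) (N : Subgroup K) [N.Normal] (hN : N ≠ ⊥)
    (hmin : ∀ L : Subgroup K, L.Normal → L ≤ N → L = ⊥ ∨ L = N)
    (hZ : N ⊓ Subgroup.center K = ⊥) (hsum : ∑ n : N, ω n = 0) :
    301 / 300 * ∑ x, ‖ω x‖ ^ 2 ≤ ∑ x, ‖ω x‖ := by
  by_contra! hlt
  obtain ⟨H, hHn, hH1, hH2, hHcard⟩ := h.exists_normal_of_sum_lt hlt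
  have hNH : N ≤ H := inf_eq_right.1 ((hmin (H ⊓ N) inferInstance inf_le_right).resolve_left
    (h.exists_mem_inf_ne_one hsum hlt hH1 hH2 hHcard))
  have hcomm : ∀ n ∈ N, ∀ g, ω (g * n * g⁻¹ * n⁻¹) = 1 := fun n hn g => by
    have h1 := hH1 n (hNH hn)
    rw [h.mul_apply_of_norm_eq_one (by rw [h.conj_apply, h1]), h.conj_apply, h.inv_apply,
      Complex.mul_conj', h1]
    simp
  -- The kernel of `ω` in `N` contains all commutators of `N` with `K`; minimality makes it trivial
  -- (`N` is central) or all of `N` (the sum over `N` is `|N|`).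
  let L : Subgroup K :=
    { carrier := {x | x ∈ N ∧ ω x = 1}
      one_mem' := ⟨N.one_mem, h.map_one⟩
      inv_mem' := fun {x} hx => ⟨N.inv_mem hx.1, by rw [h.inv_apply, hx.2]; simp⟩
      mul_mem' := fun {x y} hx hy => ⟨N.mul_mem hx.1 hy.1, by
        rw [h.mul_apply_of_norm_eq_one (by rw [hx.2, norm_one]), hx.2, hy.2, one_mul]⟩ }
  have hLn : L.Normal := ⟨fun x hx g =>
    ⟨(inferInstance : N.Normal).conj_mem x hx.1 g, by rw [h.conj_apply, hx.2]⟩⟩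
  obtain hL | hL := hmin L hLn fun x hx => hx.1
  · refine hN (le_bot_iff.1 (hZ ▸ le_inf le_rfl fun n hn => ?_))
    rw [Subgroup.mem_center_iff]
    intro g
    have : g * n * g⁻¹ * n⁻¹ ∈ L :=
      ⟨N.mul_mem ((inferInstance : N.Normal).conj_mem n hn g) (N.inv_mem hn), hcomm n hn g⟩
    rw [hL, Subgroup.mem_bot, mul_inv_eq_one, mul_inv_eq_iff_eq_mul] at this
    exact this
  · have h1 : ∀ n : N, ω n = 1 := fun n => by
      have : (n : K) ∈ L := by rw [hL]; exact n.2
      exact this.2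
    simp [h1] at hsum

end Subgroups

end IsSpherical

/-! ### Quotients, groups of class two, finite products -/

theorem MonoidHom.sum_comp_of_surjective {K L M : Type*} [Group K] [Group L] [Fintype K] [Fintype L]
    [AddCommMonoid M] (f : K →* L) (hf : Function.Surjective f) (F : L → M) :
    ∑ k, F (f k) = Nat.card f.ker • ∑ l, F l := by
  classical
  rw [← Finset.sum_fiberwise Finset.univ f, Finset.smul_sum]
  refine Finset.sum_congr rfl fun l _ => ?_
  have e : ∀ l : L, (Finset.univ.filter fun k => f k = l).card = Nat.card f.ker := fun l => by
    rw [MonoidHom.card_fiber_eq_of_mem_range f (hf l) ⟨1, f.map_one⟩]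
    exact (Nat.subtype_card (p := (· ∈ f.ker)) _ fun x => by simp [MonoidHom.mem_ker]).symm
  rw [Finset.sum_congr rfl fun k hk => by rw [(Finset.mem_filter.1 hk).2], Finset.sum_const, e]

namespace IsSpherical

variable {K : Type*} [Group K] [Fintype K] {ω : K → ℂ}

theorem comp_of_surjective {L : Type*} [Group L] [Fintype L] (h : IsSpherical ω) (f : L →* K)
    (hf : Function.Surjective f) : IsSpherical (ω ∘ f) where
  map_one := by simp [h.map_one]
  sum_conj x y := by
    have e1 := f.sum_comp_of_surjective hf fun g => ω (f x * (g * f y * g⁻¹))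
    have e2 := f.sum_comp_of_surjective hf fun _ => (1 : ℂ)
    simp only [Finset.sum_const, Finset.card_univ, nsmul_eq_mul, mul_one] at e2
    simp only [Function.comp_apply, map_mul, map_inv]
    rw [e1, h.sum_conj, e2, nsmul_eq_mul, mul_assoc]

theorem mul_apply_of_central (h : IsSpherical ω) {z : K} (hz : ∀ g, z * g = g * z) (x : K) :
    ω (x * z) = ω x * ω z := by
  have hg : ∀ g, g * z * g⁻¹ = z := fun g => by rw [← hz, mul_inv_cancel_right]
  have := h.sum_conj x z
  simp only [hg, Finset.sum_const, Finset.card_univ, nsmul_eq_mul] at this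
  exact mul_left_cancel₀ (card_ne_zero K) this

/-- On a group of nilpotency class at most two, `|ω|` only takes the values `0` and `1`. -/
theorem norm_eq_zero_or_one (h : IsSpherical ω) (hK : ∀ x y z : K, ⁅x, y⁆ * z = z * ⁅x, y⁆)
    (x : K) : ‖ω x‖ = 0 ∨ ‖ω x‖ = 1 := by
  refine or_iff_not_imp_left.2 fun hx => ?_
  have hx' : ω x ≠ 0 := by simpa using hx
  -- The commutator `z` is central and `z * x = g * x * g⁻¹`, so `ω x * ω z = ω x`, where `ω x`
  -- cancels.
  have h1 : ∀ g, ω ⁅g, x⁆ = 1 := fun g => by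
    have e := h.mul_apply_of_central (hK g x) x
    rw [← hK, commutatorElement_def, inv_mul_cancel_right, h.conj_apply] at e
    exact mul_left_cancel₀ hx' (by rw [mul_one, commutatorElement_def]; exact e.symm)
  have h2 := h.sum_conj x⁻¹ x
  have h3 : ∀ g, ω (x⁻¹ * (g * x * g⁻¹)) = 1 := fun g => by
    rw [h.mul_comm_apply]
    exact h1 g
  simp only [h3, Finset.sum_const, Finset.card_univ, nsmul_eq_mul] at h2
  have h4 := mul_left_cancel₀ (card_ne_zero K) h2
  rw [h.inv_apply, Complex.conj_mul'] at h4
  have h5 : ‖ω x‖ ^ 2 = 1 := by exact_mod_cast h4.symm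
  nlinarith [norm_nonneg (ω x), h.norm_le_one x]

section Prod

variable {K₁ K₂ : Type*} [Group K₁] [Group K₂] [Fintype K₁] [Fintype K₂] {ω : K₁ × K₂ → ℂ}

/-- Since the factors commute, the mean in the functional equation for `(a, 1)` and `(1, b)` runs
over conjugates of `(a, b)`, on which `ω` is constant. -/
theorem prod_apply (h : IsSpherical ω) (a : K₁) (b : K₂) : ω (a, b) = ω (a, 1) * ω (1, b) := by
  have h1 := h.sum_conj (a, 1) (1, b)
  have h2 : ∀ g : K₁ × K₂, ω ((a, 1) * (g * (1, b) * g⁻¹)) = ω (a, b) := fun g => by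
    rw [← h.conj_apply (1, g.2) (a, b)]
    congr 1
    ext <;> simp
  simp only [h2, Finset.sum_const, Finset.card_univ, nsmul_eq_mul] at h1
  exact mul_left_cancel₀ (card_ne_zero _) h1

theorem prod_right (h : IsSpherical ω) : IsSpherical fun b : K₂ => ω (1, b) where
  map_one := h.map_one
  sum_conj x y := by
    have h1 := h.sum_conj (1, x) (1, y)
    simp only [Fintype.sum_prod_type, Prod.mk_mul_mk, Prod.inv_mk, mul_one, mul_inv_cancel,
      Finset.sum_const, Finset.card_univ, nsmul_eq_mul, Fintype.card_prod, Nat.cast_mul] at h1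
    exact mul_left_cancel₀ (card_ne_zero K₁) (h1.trans (mul_assoc _ _ _))

/-- On `K₂` the first and second powers of `|ω|` agree. On `K₁` it is enough to bound `|ω|` by `1`
on the left and to keep only the term at the identity on the right. -/
theorem sum_norm_le_card_mul (h : IsSpherical ω)
    (hK : ∀ x y z : K₂, ⁅x, y⁆ * z = z * ⁅x, y⁆) :
    ∑ x, ‖ω x‖ ≤ Fintype.card K₁ * ∑ x, ‖ω x‖ ^ 2 := by
  have h1 : ∑ x, ‖ω x‖ ≤ Fintype.card K₁ * ∑ b, ‖ω (1, b)‖ := by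
    rw [Fintype.sum_prod_type, ← nsmul_eq_mul, ← Finset.card_univ, ← Finset.sum_const]
    refine Finset.sum_le_sum fun a _ => Finset.sum_le_sum fun b _ => ?_
    rw [h.prod_apply, norm_mul]
    exact mul_le_of_le_one_left (norm_nonneg _) (h.norm_le_one _)
  refine h1.trans (mul_le_mul_of_nonneg_left ?_ (Nat.cast_nonneg _))
  have h2 : ∀ b, ‖ω (1, b)‖ = ‖ω (1, b)‖ ^ 2 := fun b => by
    obtain h0 | h0 := h.prod_right.norm_eq_zero_or_one hK b <;> simp [h0]
  rw [Finset.sum_congr rfl fun b _ => h2 b, Fintype.sum_prod_type]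
  exact Finset.single_le_sum (f := fun a => ∑ b, ‖ω (a, b)‖ ^ 2)
    (fun a _ => Finset.sum_nonneg fun b _ => by positivity) (Finset.mem_univ 1)

end Prod

/-- A finite product of groups, all but some of which have class at most two. -/
theorem sum_norm_le_prod_mul {ι : Type*} [Fintype ι] {G : ι → Type*} [∀ i, Group (G i)]
    [∀ i, Fintype (G i)] [Fintype (∀ i, G i)] (p : ι → Prop) [DecidablePred p]
    (hp : ∀ i, ¬ p i → ∀ x y z : G i, ⁅x, y⁆ * z = z * ⁅x, y⁆) {ω : (∀ i, G i) → ℂ}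
    (h : IsSpherical ω) :
    ∑ x, ‖ω x‖ ≤ (∏ i : {i // p i}, Fintype.card (G i) : ℕ) * ∑ x, ‖ω x‖ ^ 2 := by
  classical
  let e : (∀ i, G i) ≃* (∀ i : {i // p i}, G i) × (∀ i : {i // ¬ p i}, G i) :=
    { Equiv.piEquivPiSubtypeProd p G with map_mul' := fun x y => rfl }
  have h' := h.comp_of_surjective e.symm.toMonoidHom e.symm.surjective
  have := h'.sum_norm_le_card_mul fun x y z => funext fun i => hp i i.2 _ _ _
  rw [Fintype.card_pi] at this
  have e1 := Equiv.sum_comp e.symm.toEquiv fun x => ‖ω x‖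
  have e2 := Equiv.sum_comp e.symm.toEquiv fun x => ‖ω x‖ ^ 2
  rw [← e1, ← e2]
  exact this

end IsSpherical

theorem commutatorElement_mul_comm_of_nilpotencyClass_le_two {G : Type*} [Group G]
    [Group.IsNilpotent G] (hG : Group.nilpotencyClass G ≤ 2) (x y z : G) :
    ⁅x, y⁆ * z = z * ⁅x, y⁆ := by
  rw [← Subgroup.lowerCentralSeries_eq_bot_iff_nilpotencyClass_le] at hG
  have h1 : ⁅x, y⁆ ∈ Subgroup.lowerCentralSeries (⊤ : Subgroup G) 1 := by
    rw [Subgroup.lowerCentralSeries_succ, Subgroup.lowerCentralSeries_zero]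
    exact Subgroup.commutator_mem_commutator (Subgroup.mem_top _) (Subgroup.mem_top _)
  have h2 : ⁅⁅x, y⁆, z⁆ ∈ Subgroup.lowerCentralSeries (⊤ : Subgroup G) 2 := by
    rw [Subgroup.lowerCentralSeries_succ]
    exact Subgroup.commutator_mem_commutator h1 (Subgroup.mem_top _)
  rw [hG, Subgroup.mem_bot, commutatorElement_eq_one_iff_mul_comm] at h2
  exact h2

/-! ### Point masses and the centre of `ℓ¹` -/

namespace L1

section PointMass

variable {Γ : Type u}

open scoped Classical in
/-- The point mass at `x`. -/
noncomputable def pointMass (x : Γ) : L1 Γ :=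
  mk (fun y => if y = x then 1 else 0) (summable_of_ne_finset_zero (s := {x}) fun y hy => by
    have hy : y ≠ x := by simpa using hy
    simp [hy])

open scoped Classical in
theorem pointMass_apply (x y : Γ) : pointMass x y = if y = x then 1 else 0 := rfl

@[simp] theorem norm_pointMass (x : Γ) : ‖pointMass x‖ = 1 := by
  rw [norm_eq, tsum_eq_single x fun y hy => by simp [pointMass_apply, hy]]
  simp [pointMass_apply]

@[simp] theorem sum_apply {ι : Type*} (s : Finset ι) (f : ι → L1 Γ) (x : Γ) :
    (∑ i ∈ s, f i) x = ∑ i ∈ s, f i x :=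
  map_sum (⟨⟨fun f => f x, rfl⟩, fun _ _ => rfl⟩ : L1 Γ →+ ℂ) f s

theorem hasSum_pointMass (f : L1 Γ) : HasSum (fun x => f x • pointMass x) f := by
  classical
  have hs : Summable fun x => f x • pointMass x := by
    refine Summable.of_norm ?_
    simpa [norm_smul] using f.summable_norm
  obtain ⟨g, hg⟩ := hs
  convert hg
  ext y
  let ev : L1 Γ →L[ℂ] ℂ := LinearMap.mkContinuous ⟨⟨fun f => f y, fun _ _ => rfl⟩, fun _ _ => rfl⟩ 1
    fun f => by rw [one_mul]; exact norm_apply_le f y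
  have h1 : HasSum (fun x => f x * pointMass x y) (g y) := hg.mapL ev
  refine HasSum.unique ?_ h1
  convert hasSum_single (f := fun x => f x * pointMass x y) y fun x hx => by
    simp [pointMass_apply, hx.symm]
  simp [pointMass_apply]

/-- Point masses span a dense subspace; identities between continuous linear maps are checked on
them throughout. -/
theorem eq_of_pointMass {V : Type*} [NormedAddCommGroup V] [NormedSpace ℂ V] {S T : L1 Γ →L[ℂ] V}
    (h : ∀ x, S (pointMass x) = T (pointMass x)) (f : L1 Γ) : S f = T f := by
  have h1 := (hasSum_pointMass f).mapL S
  have h2 := (hasSum_pointMass f).mapL T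
  simp only [map_smul, h] at h1 h2
  exact h1.unique h2

theorem summable_norm_mul (f : L1 Γ) {ψ : Γ → ℂ} (hψ : ∀ x, ‖ψ x‖ ≤ 1) :
    Summable fun x => ‖f x * ψ x‖ :=
  Summable.of_nonneg_of_le (fun _ => norm_nonneg _)
    (fun x => by rw [norm_mul]; exact mul_le_of_le_one_right (norm_nonneg _) (hψ x))
    f.summable_norm

theorem norm_tsum_mul_le (f : L1 Γ) {ψ : Γ → ℂ} (hψ : ∀ x, ‖ψ x‖ ≤ 1) :
    ‖∑' x, f x * ψ x‖ ≤ ‖f‖ := by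
  have hs := f.summable_norm_mul hψ
  rw [norm_eq]
  refine (norm_tsum_le_tsum_norm hs).trans (hs.tsum_le_tsum (fun x => ?_) f.summable_norm)
  rw [norm_mul]
  exact mul_le_of_le_one_right (norm_nonneg _) (hψ x)

/-- Integration against a function bounded by `1`. -/
noncomputable def pairing (ψ : Γ → ℂ) (hψ : ∀ x, ‖ψ x‖ ≤ 1) : L1 Γ →L[ℂ] ℂ :=
  LinearMap.mkContinuous
    { toFun := fun f => ∑' x, f x * ψ x
      map_add' := fun f g => by
        simp only [add_apply, add_mul]
        exact (f.summable_norm_mul hψ).of_norm.tsum_add (g.summable_norm_mul hψ).of_norm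
      map_smul' := fun c f => by
        simp only [smul_apply, mul_assoc, tsum_mul_left, RingHom.id_apply, smul_eq_mul] } 1
    fun f => by rw [one_mul]; exact f.norm_tsum_mul_le hψ

theorem pairing_apply (ψ : Γ → ℂ) (hψ : ∀ x, ‖ψ x‖ ≤ 1) (f : L1 Γ) :
    pairing ψ hψ f = ∑' x, f x * ψ x := rfl

theorem norm_pairing_le (ψ : Γ → ℂ) (hψ : ∀ x, ‖ψ x‖ ≤ 1) (f : L1 Γ) :
    ‖pairing ψ hψ f‖ ≤ ‖f‖ :=
  f.norm_tsum_mul_le hψ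

@[simp] theorem pairing_pointMass (ψ : Γ → ℂ) (hψ : ∀ x, ‖ψ x‖ ≤ 1) (x : Γ) :
    pairing ψ hψ (pointMass x) = ψ x := by
  rw [pairing_apply, tsum_eq_single x fun y hy => by simp [pointMass_apply, hy]]
  simp [pointMass_apply]

end PointMass

section Group

variable {Γ : Type u} [Group Γ]

@[simp] theorem pointMass_mul (x y : Γ) : pointMass x * pointMass y = pointMass (x * y) := by
  ext z
  rw [mul_apply, tsum_eq_single x fun w hw => by simp [pointMass_apply, hw]]
  simp only [pointMass_apply, if_true, one_mul]
  by_cases h : z = x * y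
  · simp [h]
  · rw [if_neg h, if_neg fun h' => h (inv_mul_eq_iff_eq_mul.1 h')]

theorem pointMass_one : pointMass (1 : Γ) = 1 := rfl

theorem pointMass_mul_apply (x y : Γ) (f : L1 Γ) : (pointMass x * f) y = f (x⁻¹ * y) := by
  rw [mul_apply, tsum_eq_single x fun w hw => by simp [pointMass_apply, hw]]
  simp [pointMass_apply]

theorem mul_pointMass_apply (x y : Γ) (f : L1 Γ) : (f * pointMass x) y = f (y * x⁻¹) := by
  rw [mul_apply, tsum_eq_single (y * x⁻¹) fun w hw => by
    have : w⁻¹ * y ≠ x := fun h => hw (by rw [← h]; simp)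
    simp [pointMass_apply, this]]
  simp [pointMass_apply]

theorem mem_center_of_pointMass {f : L1 Γ}
    (h : ∀ x, pointMass x * f = f * pointMass x) : f ∈ Subalgebra.center ℂ (L1 Γ) := by
  rw [Subalgebra.mem_center_iff]
  intro g
  exact eq_of_pointMass (S := (ContinuousLinearMap.mul ℂ (L1 Γ)).flip f)
    (T := ContinuousLinearMap.mul ℂ (L1 Γ) f) (by simpa using h) g

theorem conj_apply_of_mem_center {f : L1 Γ} (hf : f ∈ Subalgebra.center ℂ (L1 Γ)) (g x : Γ) :
    f (g * x * g⁻¹) = f x := by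
  have h := congrArg (fun k : L1 Γ => k (g * x)) (Subalgebra.mem_center_iff.1 hf (pointMass g))
  simpa [pointMass_mul_apply, mul_pointMass_apply] using h.symm

end Group

end L1

/-! ### Finite direct factors and the restriction of characters -/

/-- A group `Γ` with a direct factor `K`. -/
structure DirectFactor (K : Type*) (Γ : Type*) [Group K] [Group Γ] where
  /-- The inclusion of the factor. -/
  incl : K →* Γ
  /-- The projection to the factor. -/
  proj : Γ →* K
  proj_incl : ∀ k, proj (incl k) = k
  conj_incl : ∀ x k, x * incl k * x⁻¹ = incl (proj x * k * (proj x)⁻¹)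

namespace DirectFactor

variable {K : Type*} {Γ : Type u} [Group K] [Group Γ]

/-- Every group is a direct factor of itself. -/
def refl (Γ : Type*) [Group Γ] : DirectFactor Γ Γ :=
  ⟨MonoidHom.id Γ, MonoidHom.id Γ, fun _ => rfl, fun _ _ => rfl⟩

variable (D : DirectFactor K Γ)

theorem incl_injective : Function.Injective D.incl :=
  Function.LeftInverse.injective D.proj_incl

variable [Fintype K]

/-- The extension by zero of a function on a direct factor. -/
noncomputable def extend (h : K → ℂ) : L1 Γ := ∑ k, h k • L1.pointMass (D.incl k)

theorem extend_incl (h : K → ℂ) (k : K) : D.extend h (D.incl k) = h k := by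
  classical
  simp [extend, L1.pointMass_apply, D.incl_injective.eq_iff]

theorem norm_extend_le (h : K → ℂ) : ‖D.extend h‖ ≤ ∑ k, ‖h k‖ :=
  (norm_sum_le _ _).trans_eq (Finset.sum_congr rfl fun k _ => by rw [norm_smul]; simp)

theorem extend_mem_center {h : K → ℂ} (hh : ∀ g x, h (g * x * g⁻¹) = h x) :
    D.extend h ∈ Subalgebra.center ℂ (L1 Γ) := by
  refine L1.mem_center_of_pointMass fun x => ?_
  simp only [extend, Finset.mul_sum, Finset.sum_mul, mul_smul_comm, smul_mul_assoc,
    L1.pointMass_mul]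
  rw [← Equiv.sum_comp (MulAut.conj (D.proj x)).toEquiv fun k => h k • L1.pointMass (D.incl k * x)]
  refine Finset.sum_congr rfl fun k _ => ?_
  change _ = h (D.proj x * k * (D.proj x)⁻¹) •
    L1.pointMass (D.incl (D.proj x * k * (D.proj x)⁻¹) * x)
  rw [hh, ← D.conj_incl, inv_mul_cancel_right]

/-- The mean of the point masses on a conjugacy class of a direct factor. -/
noncomputable def classMean (x : K) : ZL1 Γ :=
  ⟨(Fintype.card K : ℂ)⁻¹ • ∑ g, L1.pointMass (D.incl (g * x * g⁻¹)), by
    refine Subalgebra.smul_mem _ (L1.mem_center_of_pointMass fun y => ?_) _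
    rw [Finset.mul_sum, Finset.sum_mul, ← Equiv.sum_comp (Equiv.mulLeft (D.proj y))
      fun g => L1.pointMass (D.incl (g * x * g⁻¹)) * L1.pointMass y]
    refine Finset.sum_congr rfl fun g _ => ?_
    have := D.conj_incl y (g * x * g⁻¹)
    rw [mul_inv_eq_iff_eq_mul] at this
    change _ = L1.pointMass (D.incl (D.proj y * g * x * (D.proj y * g)⁻¹)) * L1.pointMass y
    rw [L1.pointMass_mul, L1.pointMass_mul, this]
    congr 3
    group⟩

theorem coe_classMean (x : K) : (D.classMean x : L1 Γ) =
    (Fintype.card K : ℂ)⁻¹ • ∑ g, L1.pointMass (D.incl (g * x * g⁻¹)) := rfl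

theorem classMean_one : D.classMean 1 = 1 := by
  refine Subtype.ext ?_
  rw [coe_classMean]
  simp only [mul_one, mul_inv_cancel, map_one, Finset.sum_const, Finset.card_univ]
  rw [← Nat.cast_smul_eq_nsmul ℂ, smul_smul, inv_mul_cancel₀ (IsSpherical.card_ne_zero K), one_smul]
  rfl

/-- This is the functional equation of spherical functions inside the algebra; applying a character
to it yields `isSpherical_classMean`. -/
theorem classMean_mul (x y : K) : D.classMean x * D.classMean y =
    (Fintype.card K : ℂ)⁻¹ • ∑ g, D.classMean (x * (g * y * g⁻¹)) := by
  refine Subtype.ext ?_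
  have e : ((∑ g, D.classMean (x * (g * y * g⁻¹)) : ZL1 Γ) : L1 Γ) =
      ∑ g, (D.classMean (x * (g * y * g⁻¹)) : L1 Γ) := by
    simp
  change (D.classMean x : L1 Γ) * D.classMean y = (Fintype.card K : ℂ)⁻¹ •
    ((∑ g, D.classMean (x * (g * y * g⁻¹)) : ZL1 Γ) : L1 Γ)
  rw [e]
  simp only [coe_classMean, smul_mul_assoc, mul_smul_comm, ← Finset.smul_sum, Finset.sum_mul_sum,
    L1.pointMass_mul, ← map_mul]
  congr 2
  rw [Finset.sum_comm (s := Finset.univ (α := K)) (t := Finset.univ (α := K))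
    (f := fun g h => L1.pointMass (D.incl (h * (x * (g * y * g⁻¹)) * h⁻¹)))]
  refine Finset.sum_congr rfl fun g _ => ?_
  rw [← Equiv.sum_comp (Equiv.mulLeft g)]
  refine Finset.sum_congr rfl fun h _ => ?_
  simp [mul_assoc]

/-- A character of `Zℓ¹(Γ)` restricts to a spherical function on each finite direct factor. -/
theorem isSpherical_classMean (φ : ZL1 Γ →ₐ[ℂ] ℂ) : IsSpherical fun k => φ (D.classMean k) where
  map_one := by rw [classMean_one, map_one]
  sum_conj x y := by
    have e := φ.toLinearMap.map_smul (Fintype.card K : ℂ)⁻¹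
      (∑ g, D.classMean (x * (g * y * g⁻¹)))
    rw [AlgHom.toLinearMap_apply, AlgHom.toLinearMap_apply] at e
    rw [← map_mul, classMean_mul, e, map_sum, smul_eq_mul,
      mul_inv_cancel_left₀ (IsSpherical.card_ne_zero K)]

theorem extend_eq_sum_classMean {h : K → ℂ} (hh : ∀ g x, h (g * x * g⁻¹) = h x) :
    (⟨D.extend h, D.extend_mem_center hh⟩ : ZL1 Γ) = ∑ k, h k • D.classMean k := by
  refine Subtype.ext ?_
  have e : ((∑ k, h k • D.classMean k : ZL1 Γ) : L1 Γ) = ∑ k, h k • (D.classMean k : L1 Γ) := by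
    simp
  rw [e]
  simp only [coe_classMean, smul_comm _ (Fintype.card K : ℂ)⁻¹, ← Finset.smul_sum]
  rw [eq_inv_smul_iff₀ (IsSpherical.card_ne_zero K)]
  simp only [Finset.smul_sum]
  rw [Finset.sum_comm]
  have e2 : ∀ g : K, ∑ k, h k • L1.pointMass (D.incl (g * k * g⁻¹)) = D.extend h := fun g => by
    rw [extend, ← Equiv.sum_comp (MulAut.conj g).toEquiv fun k => h k • L1.pointMass (D.incl k)]
    refine Finset.sum_congr rfl fun k _ => ?_
    change _ = h (g * k * g⁻¹) • L1.pointMass (D.incl (g * k * g⁻¹))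
    rw [hh]
  simp only [e2, Finset.sum_const, Finset.card_univ]
  rw [Nat.cast_smul_eq_nsmul]

theorem character_extend (φ : ZL1 Γ →ₐ[ℂ] ℂ) {h : K → ℂ} (hh : ∀ g x, h (g * x * g⁻¹) = h x) :
    φ ⟨D.extend h, D.extend_mem_center hh⟩ = ∑ k, h k * φ (D.classMean k) := by
  rw [D.extend_eq_sum_classMean hh, map_sum]
  exact Finset.sum_congr rfl fun k _ => φ.toLinearMap.map_smul _ _

end DirectFactor

/-! ### Maximal ideals as kernels of characters -/

namespace ZL1

variable {Γ : Type u} [Group Γ]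

theorem isClosed_center : IsClosed (Subalgebra.center ℂ (L1 Γ) : Set (L1 Γ)) := by
  have : (Subalgebra.center ℂ (L1 Γ) : Set (L1 Γ)) = ⋂ g : L1 Γ, {f | g * f = f * g} := by
    ext f
    rw [SetLike.mem_coe, Subalgebra.mem_center_iff, Set.mem_iInter]
    rfl
  rw [this]
  exact isClosed_iInter fun g => isClosed_eq (by fun_prop) (by fun_prop)

instance : CompleteSpace (ZL1 Γ) :=
  (isClosed_center (Γ := Γ)).completeSpace_coe

/-- Every maximal ideal of `Zℓ¹(Γ)` is the kernel of a continuous character. -/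
theorem exists_character (J : Ideal (ZL1 Γ)) (hJ : J.IsMaximal) :
    ∃ φ : ZL1 Γ →ₐ[ℂ] ℂ, Continuous φ ∧ ∀ f, f ∈ J ↔ φ f = 0 := by
  -- Gelfand–Mazur supplies a character vanishing on `J`; maximality then identifies `J` with its
  -- kernel.
  let χ := @Ideal.toCharacterSpace (ZL1 Γ) _ _ _ J hJ
  have h0 : ∀ f ∈ J, χ f = 0 := fun f hf => J.toCharacterSpace_apply_eq_zero_of_mem hf
  let φ : ZL1 Γ →ₐ[ℂ] ℂ := WeakDual.CharacterSpace.toAlgHom χ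
  refine ⟨φ, map_continuous χ, fun f => ⟨h0 f, fun hf => ?_⟩⟩
  have hle : J ≤ RingHom.ker φ := fun g hg => (RingHom.mem_ker).2 (h0 g hg)
  rw [hJ.eq_of_le (RingHom.ker_ne_top φ) hle]
  exact (RingHom.mem_ker).2 hf

end ZL1

/-! ### The gap for non-nilpotent finite groups -/

namespace IsSpherical

open scoped Classical in
/-- Every nontrivial normal subgroup of a finite group is annihilated by a spherical function. -/
theorem exists_sum_eq_zero {K : Type u} [Group K] [Fintype K] (N : Subgroup K) [N.Normal]
    (hN : N ≠ ⊥) : ∃ ω : K → ℂ, IsSpherical ω ∧ ∑ n : N, ω n = 0 := by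
  let D := DirectFactor.refl K
  -- The uniform mean on `N` is absorbed by translation by any `n ∈ N`, so it is not invertible when
  -- `N ≠ ⊥`. A character vanishing on it restricts to the required `ω`.
  let h : K → ℂ := fun x => if x ∈ N then (Fintype.card N : ℂ)⁻¹ else 0
  have hh : ∀ g x, h (g * x * g⁻¹) = h x := fun g x => by
    have : g * x * g⁻¹ ∈ N ↔ x ∈ N := (Subgroup.Normal.mem_comm_iff ‹_›).trans (by simp)
    simp only [h, this]
  let e : ZL1 K := ⟨D.extend h, D.extend_mem_center hh⟩
  have happ : ∀ x, (e : L1 K) x = h x := D.extend_incl h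
  obtain ⟨⟨n, hn⟩, hn1⟩ := Subgroup.ne_bot_iff_exists_ne_one.1 hN
  have hcard : (Fintype.card N : ℂ) ≠ 0 := card_ne_zero N
  have hmul : L1.pointMass n * (e : L1 K) = e := by
    ext x
    rw [L1.pointMass_mul_apply, happ, happ]
    have : n⁻¹ * x ∈ N ↔ x ∈ N := N.mul_mem_cancel_left (N.inv_mem hn)
    simp only [h, this]
  have hunit : ¬ IsUnit e := fun hu => by
    obtain ⟨f, hf⟩ := hu.exists_right_inv
    have hf' : (e : L1 K) * f = 1 := congrArg (Subtype.val) hf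
    have h1 : L1.pointMass n = 1 := by
      rw [← mul_one (L1.pointMass n), ← hf', ← mul_assoc, hmul]
    have h2 := congrArg (fun k : L1 K => k 1) h1
    have h3 : 1 ≠ n := fun h => hn1 (Subtype.ext h.symm)
    simp [L1.pointMass_apply, L1.one_apply, h3] at h2
  obtain ⟨J, hJ, heJ⟩ := exists_max_ideal_of_mem_nonunits hunit
  obtain ⟨φ, -, hφ⟩ := ZL1.exists_character J hJ
  refine ⟨_, D.isSpherical_classMean φ, ?_⟩
  have h1 := (hφ e).1 heJ
  rw [D.character_extend φ hh] at h1
  simp only [h, ite_mul, zero_mul, ← Finset.sum_filter] at h1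
  rw [Finset.sum_subtype (p := (· ∈ N)) _ (by simp), ← Finset.mul_sum] at h1
  exact (mul_eq_zero.1 h1).resolve_left (inv_ne_zero hcard)

/-- A finite group that is not nilpotent has a central idempotent, given by an irreducible
character, of `ℓ¹`-norm at least `1 + 1/300`. -/
theorem exists_gap_of_not_isNilpotent (n : ℕ) : ∀ (K : Type u) [Group K] [Fintype K],
    Nat.card K = n → ¬ Group.IsNilpotent K →
    ∃ ω : K → ℂ, IsSpherical ω ∧ 301 / 300 * ∑ x, ‖ω x‖ ^ 2 ≤ ∑ x, ‖ω x‖ := by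
  classical
  induction n using Nat.strong_induction_on with
  | _ n ih =>
    intro K _ _ hn hK
    by_cases hZ : Subgroup.center K = ⊥
    · have hnt : (⊤ : Subgroup K) ≠ ⊥ := fun h => hK (by
        have : Subsingleton K := Subgroup.subsingleton_iff.1 (subsingleton_of_bot_eq_top h.symm)
        infer_instance)
      obtain ⟨N, hN⟩ := (Set.toFinite {L : Subgroup K | L.Normal ∧ L ≠ ⊥}).exists_minimal
        ⟨⊤, inferInstance, hnt⟩
      have hNn : N.Normal := hN.prop.1
      obtain ⟨ω, hω, hsum⟩ := exists_sum_eq_zero N hN.prop.2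
      refine ⟨ω, hω, hω.gap N hN.prop.2 (fun L hL hLN => ?_) (by rw [hZ, inf_bot_eq]) hsum⟩
      refine or_iff_not_imp_left.2 fun hL0 => le_antisymm hLN (hN.le_of_le ⟨hL, hL0⟩ hLN)
    · have hlt : Nat.card (K ⧸ Subgroup.center K) < n := by
        rw [← hn, Subgroup.card_eq_card_quotient_mul_card_subgroup (Subgroup.center K)]
        exact lt_mul_of_one_lt_right Nat.card_pos ((Subgroup.one_lt_card_iff_ne_bot _).2 hZ)
      -- The gap survives pulling back to `K`: both sums are multiplied by the order of the centre.
      obtain ⟨ω, hω, hgap⟩ := ih _ hlt (K ⧸ Subgroup.center K) rfl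
        fun h => hK (Group.of_quotient_center_nilpotent h)
      have hs := QuotientGroup.mk'_surjective (Subgroup.center K)
      refine ⟨_, hω.comp_of_surjective (QuotientGroup.mk' (Subgroup.center K)) hs, ?_⟩
      simp only [Function.comp_apply]
      rw [MonoidHom.sum_comp_of_surjective _ hs fun x => ‖ω x‖ ^ 2,
        MonoidHom.sum_comp_of_surjective _ hs fun x => ‖ω x‖, nsmul_eq_mul, nsmul_eq_mul,
        mul_left_comm]
      exact mul_le_mul_of_nonneg_left hgap (Nat.cast_nonneg _)

end IsSpherical

/-! ### Approximate identities bound the norms of idempotents -/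

namespace DirectFactor

variable {K : Type*} {Γ : Type u} [Group K] [Group Γ] (D : DirectFactor K Γ)

/-- The component of an element in the complement of a direct factor. -/
def compl (x : Γ) : Γ := x * (D.incl (D.proj x))⁻¹

theorem compl_mul_incl (x : Γ) (k : K) : D.compl (x * D.incl k) = D.compl x := by
  simp [compl, D.proj_incl, mul_assoc]

theorem compl_conj_incl (x : Γ) (g : K) : D.compl (D.incl g * x * (D.incl g)⁻¹) = D.compl x := by
  have h := D.conj_incl (D.compl x) g
  have h1 : D.proj (D.compl x) = 1 := by simp [compl, D.proj_incl]
  rw [h1, one_mul, inv_one, mul_one, mul_inv_eq_iff_eq_mul] at h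
  have h2 : D.compl (D.incl g * x * (D.incl g)⁻¹) = D.incl g * D.compl x * (D.incl g)⁻¹ := by
    simp [compl, D.proj_incl, mul_assoc]
  rw [h2, ← h, mul_inv_cancel_right]

variable [Fintype K]

/-- A function on `Γ` that is the product of a spherical function on a direct factor and a function
on the complement. -/
structure Splits (ω : Γ → ℂ) : Prop where
  isSpherical : IsSpherical (ω ∘ D.incl)
  apply_eq : ∀ x, ω x = ω (D.incl (D.proj x)) * ω (D.compl x)

namespace Splits

variable {D} {ω : Γ → ℂ}

theorem mul_incl (h : D.Splits ω) (x : Γ) (k : K) :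
    ω (x * D.incl k) = ω (D.incl (D.proj x * k)) * ω (D.compl x) := by
  rw [h.apply_eq, D.compl_mul_incl, map_mul, D.proj_incl]

theorem conj_incl (h : D.Splits ω) (g : K) (x : Γ) :
    ω (D.incl g * x * (D.incl g)⁻¹) = ω x := by
  have h1 := h.isSpherical.conj_apply g (D.proj x)
  rw [h.apply_eq, D.compl_conj_incl, h.apply_eq x]
  simp only [Function.comp_apply] at h1
  simp only [map_mul, map_inv, D.proj_incl] at h1 ⊢
  rw [h1]

theorem sum_conj (h : D.Splits ω) (x : Γ) (k : K) :
    ∑ g, ω (x * D.incl (g * k * g⁻¹)) = Fintype.card K * (ω x * ω (D.incl k)) := by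
  have h1 := h.isSpherical.sum_conj (D.proj x) k
  simp only [Function.comp_apply] at h1
  simp only [h.mul_incl, ← Finset.sum_mul, h1, h.apply_eq x]
  ring

/-- As `f` is central and `ω` is invariant under conjugation by the factor, replacing `k` by a
conjugate does not change the left side; averaging over conjugates reduces to `sum_conj`. -/
theorem pairing_mul_pointMass (h : D.Splits ω) (hω : ∀ x, ‖ω x‖ ≤ 1) {f : L1 Γ}
    (hf : f ∈ Subalgebra.center ℂ (L1 Γ)) (k : K) :
    L1.pairing ω hω (f * L1.pointMass (D.incl k)) = L1.pairing ω hω f * ω (D.incl k) := by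
  have h1 : ∀ g F, L1.pairing ω hω
      (L1.pointMass (D.incl g) * F * L1.pointMass (D.incl g)⁻¹) = L1.pairing ω hω F := fun g F =>
    L1.eq_of_pointMass (T := L1.pairing ω hω) (S := (L1.pairing ω hω).comp
      (((ContinuousLinearMap.mul ℂ (L1 Γ)).flip (L1.pointMass (D.incl g)⁻¹)).comp
      (ContinuousLinearMap.mul ℂ (L1 Γ) (L1.pointMass (D.incl g)))))
      (fun x => by simp [h.conj_incl]) F
  have h2 : ∀ F, ∑ g, L1.pairing ω hω (F * L1.pointMass (D.incl (g * k * g⁻¹))) =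
      Fintype.card K * (L1.pairing ω hω F * ω (D.incl k)) := fun F => by
    have := L1.eq_of_pointMass (T := (Fintype.card K * ω (D.incl k)) • L1.pairing ω hω)
      (S := ∑ g, (L1.pairing ω hω).comp
      ((ContinuousLinearMap.mul ℂ (L1 Γ)).flip (L1.pointMass (D.incl (g * k * g⁻¹)))))
      (fun x => by
        rw [sum_apply]
        simp only [ContinuousLinearMap.comp_apply, ContinuousLinearMap.flip_apply,
          ContinuousLinearMap.mul_apply', L1.pointMass_mul, L1.pairing_pointMass, h.sum_conj,
          smul_apply, smul_eq_mul]
        ring) F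
    rw [sum_apply] at this
    simp only [ContinuousLinearMap.comp_apply, ContinuousLinearMap.flip_apply,
      ContinuousLinearMap.mul_apply', smul_apply, smul_eq_mul] at this
    rw [this]
    ring
  have h3 : ∀ g, L1.pairing ω hω (f * L1.pointMass (D.incl (g * k * g⁻¹))) =
      L1.pairing ω hω (f * L1.pointMass (D.incl k)) := fun g => by
    rw [← h1 g (f * L1.pointMass (D.incl k)), ← mul_assoc (L1.pointMass _) f,
      Subalgebra.mem_center_iff.1 hf (L1.pointMass (D.incl g)), mul_assoc f, mul_assoc f,
      L1.pointMass_mul, L1.pointMass_mul, D.incl.map_mul, D.incl.map_mul, D.incl.map_inv]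
  have h4 := h2 f
  simp only [h3, Finset.sum_const, Finset.card_univ, nsmul_eq_mul] at h4
  exact mul_left_cancel₀ (IsSpherical.card_ne_zero K) h4

open scoped Classical in
/-- Pairing with the phase of `ω` on the direct factor detects the norm of the idempotent. -/
theorem sum_norm_le (h : D.Splits ω) (hω : ∀ x, ‖ω x‖ ≤ 1) (u : L1 Γ) :
    ‖L1.pairing ω hω u‖ * ∑ k, ‖ω (D.incl k)‖ ≤
      ‖u * D.extend fun k => conj (ω (D.incl k))‖ := by
  -- At `z = 0` the phase is `0`, which keeps `ψ` bounded by `1`.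
  let sgn : ℂ → ℂ := fun z => z / ‖z‖
  let ψ : Γ → ℂ := fun x => sgn (ω (D.incl (D.proj x))) * ω (D.compl x)
  have hψ : ∀ x, ‖ψ x‖ ≤ 1 := fun x => by
    simp only [ψ, sgn, norm_mul, norm_div, Complex.norm_real, norm_norm]
    exact mul_le_one₀ (div_self_le_one _) (norm_nonneg _) (hω _)
  have hsgn : ∀ z, sgn z * conj z = ‖z‖ := fun z => by
    simp only [sgn, div_mul_eq_mul_div, Complex.mul_conj']
    by_cases hz : z = 0
    · simp [hz]
    · rw [sq, mul_self_div_self]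
  -- The phase of `ω` is a class function, so `ω` is an eigenvector of convolution by it, with
  -- eigenvalue `∑ |ω|`.
  have key : ∀ a, ∑ k, conj (ω (D.incl k)) * sgn (ω (D.incl (a * k))) =
      (∑ k, ‖ω (D.incl k)‖ : ℝ) * ω (D.incl a) := fun a => by
    have hs := h.isSpherical
    have h1 := hs.sum_mul_inv_mul (a := fun k => sgn (ω (D.incl k)))
      (fun g x => congrArg sgn (hs.conj_apply g x)) a
    have h2 : ∑ k, sgn (ω (D.incl k)) * (ω ∘ D.incl) k⁻¹ = (∑ k, ‖ω (D.incl k)‖ : ℝ) := by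
      push_cast
      exact Finset.sum_congr rfl fun k _ => by rw [hs.inv_apply]; exact hsgn _
    rw [h2] at h1
    refine Eq.trans ?_ h1
    rw [← Equiv.sum_comp (Equiv.mulLeft a⁻¹)]
    refine Finset.sum_congr rfl fun k _ => ?_
    have h3 : conj (ω (D.incl (a⁻¹ * k))) = ω (D.incl (k⁻¹ * a)) := by
      have := hs.inv_apply (a⁻¹ * k)
      rw [mul_inv_rev, inv_inv] at this
      exact this.symm
    rw [Equiv.coe_mulLeft, h3, mul_inv_cancel_left, mul_comm]
    rfl
  have hpair : ∀ x, L1.pairing ψ hψ (L1.pointMass x * D.extend fun k => conj (ω (D.incl k))) =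
      (∑ k, ‖ω (D.incl k)‖ : ℝ) * ω x := fun x => by
    simp only [extend, Finset.mul_sum, mul_smul_comm, L1.pointMass_mul, map_sum, map_smul,
      L1.pairing_pointMass, smul_eq_mul]
    simp only [ψ, D.compl_mul_incl, map_mul, D.proj_incl]
    simp only [← mul_assoc, ← Finset.sum_mul]
    simp only [← map_mul, key]
    rw [mul_assoc, ← h.apply_eq]
  have := L1.eq_of_pointMass (T := ((∑ k, ‖ω (D.incl k)‖ : ℝ) : ℂ) • L1.pairing ω hω)
    (S := (L1.pairing ψ hψ).comp
      ((ContinuousLinearMap.mul ℂ (L1 Γ)).flip (D.extend fun k => conj (ω (D.incl k)))))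
    (fun x => by simpa using hpair x) u
  simp only [ContinuousLinearMap.comp_apply, ContinuousLinearMap.flip_apply,
      ContinuousLinearMap.mul_apply', smul_apply, smul_eq_mul] at this
  have h5 := L1.norm_pairing_le ψ hψ (u * D.extend fun k => conj (ω (D.incl k)))
  rw [this, norm_mul, Complex.norm_real, Real.norm_of_nonneg
    (Finset.sum_nonneg fun k _ => norm_nonneg _)] at h5
  rwa [mul_comm]

/-- The element `1 - E` lies in `J`, so some `e` in the net satisfies `‖e (1 - E) - (1 - E)‖ < 1`.
Then `(1 - e) E = (1 - e) + (e (1 - E) - (1 - E))` has norm at most `(1 + M) + 1`. The character is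
`1` at `1 - e`, so `sum_norm_le` bounds this norm below by `∑ |ω| / ∑ |ω|²`. -/
theorem sum_norm_le_mul_of_approxIdentity (h : D.Splits ω) (hω : ∀ x, ‖ω x‖ ≤ 1)
    {J : Ideal (ZL1 Γ)} (hJ : ∀ f : ZL1 Γ, f ∈ J ↔ L1.pairing ω hω f = 0) {M : ℝ}
    (hM : J.HasApproxIdentityOfNormLE M) :
    ∑ k, ‖ω (D.incl k)‖ ≤ (M + 2) * ∑ k, ‖ω (D.incl k)‖ ^ 2 := by
  obtain ⟨ι, _, _, _, e, heJ, heM, he⟩ := hM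
  have hs := h.isSpherical
  set S : ℝ := ∑ k, ‖ω (D.incl k)‖ ^ 2 with hS
  have hS1 : 1 ≤ S := hs.one_le_sum_sq
  have hS0 : (S : ℂ) ≠ 0 := Complex.ofReal_ne_zero.2 (by linarith)
  let E : ZL1 Γ := (S : ℂ)⁻¹ • ⟨D.extend fun k => conj (ω (D.incl k)),
    D.extend_mem_center hs.comp_conj.conj_apply⟩
  have hE : (E : L1 Γ) = (S : ℂ)⁻¹ • D.extend fun k => conj (ω (D.incl k)) := rfl
  have hone : L1.pairing ω hω ((1 : ZL1 Γ) : L1 Γ) = 1 := by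
    change L1.pairing ω hω (L1.pointMass 1) = 1
    rw [L1.pairing_pointMass]
    simpa using hs.map_one
  have hpE : L1.pairing ω hω E = 1 := by
    rw [hE, map_smul, extend, map_sum, smul_eq_mul, inv_mul_eq_one₀ hS0, hS]
    push_cast
    refine Finset.sum_congr rfl fun k _ => ?_
    rw [map_smul, L1.pairing_pointMass, smul_eq_mul, Complex.conj_mul']
  have hEJ : 1 - E ∈ J := by
    rw [hJ]
    change L1.pairing ω hω (((1 : ZL1 Γ) : L1 Γ) - E) = 0
    rw [map_sub, hone, hpE, sub_self]
  obtain ⟨d, hd⟩ := ((Metric.tendsto_nhds.1 (he _ hEJ)) 1 one_pos).exists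
  rw [dist_eq_norm] at hd
  have hd' : ‖((e d : L1 Γ) * (1 - E) - (1 - E) : L1 Γ)‖ < 1 := hd
  have heM' : ‖(e d : L1 Γ)‖ ≤ M := heM d
  have he0 : L1.pairing ω hω (e d) = 0 := (hJ _).1 (heJ d)
  have h1 := h.sum_norm_le hω (1 - (e d : L1 Γ))
  have h2 : L1.pairing ω hω (1 - (e d : L1 Γ)) = 1 := by
    rw [map_sub, he0, sub_zero]; exact hone
  have h3 : (1 - (e d : L1 Γ)) * D.extend (fun k => conj (ω (D.incl k))) =
      (S : ℂ) • ((1 - e d : L1 Γ) + ((e d : L1 Γ) * (1 - E) - (1 - E))) := by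
    have : (1 - e d : L1 Γ) + ((e d : L1 Γ) * (1 - E) - (1 - E)) = (1 - e d) * E := by noncomm_ring
    rw [this, hE, mul_smul_comm, smul_smul, mul_inv_cancel₀ hS0, one_smul]
  rw [h2, norm_one, one_mul, h3, norm_smul, Complex.norm_real, Real.norm_of_nonneg
    (by linarith)] at h1
  have h4 : ‖(1 : L1 Γ)‖ = 1 := L1.norm_pointMass 1
  have h5 := norm_add_le (1 - e d : L1 Γ) ((e d : L1 Γ) * (1 - E) - (1 - E))
  have h6 := norm_sub_le (1 : L1 Γ) (e d)
  rw [mul_comm]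
  exact h1.trans (mul_le_mul_of_nonneg_left (by linarith) (by linarith))

end Splits

end DirectFactor

/-! ### Product characters of the restricted product, and part (a) -/

/-- The character of `Zℓ¹(Γ)` given by a bounded function. -/
noncomputable def ZL1.characterOfPairing {Γ : Type u} [Group Γ] (ω : Γ → ℂ) (hω : ∀ x, ‖ω x‖ ≤ 1)
    (h1 : ω 1 = 1) (hmul : ∀ f ∈ Subalgebra.center ℂ (L1 Γ), ∀ x,
      L1.pairing ω hω (f * L1.pointMass x) = L1.pairing ω hω f * ω x) : ZL1 Γ →ₐ[ℂ] ℂ :=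
  AlgHom.ofLinearMap ((L1.pairing ω hω).toLinearMap ∘ₗ (Subalgebra.center ℂ (L1 Γ)).val.toLinearMap)
    ((L1.pairing_pointMass ω hω 1).trans h1)
    fun f g => by
      have := L1.eq_of_pointMass (S := (L1.pairing ω hω).comp (ContinuousLinearMap.mul ℂ (L1 Γ) f))
        (T := L1.pairing ω hω f • L1.pairing ω hω)
        (fun x => by simpa using hmul f f.2 x) g
      exact this

theorem IsSpherical.pi {ι : Type*} [Fintype ι] [DecidableEq ι] {H : ι → Type*} [∀ i, Group (H i)]
    [∀ i, Fintype (H i)] {w : ∀ i, H i → ℂ} (hw : ∀ i, IsSpherical (w i)) :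
    IsSpherical fun x : ∀ i, H i => ∏ i, w i (x i) where
  map_one := by simp [(hw _).map_one]
  sum_conj x y := by
    have h := Finset.prod_univ_sum (fun i => (Finset.univ : Finset (H i)))
      fun i g => w i (x i * (g * y i * g⁻¹))
    rw [Fintype.piFinset_univ] at h
    simp only [Pi.mul_apply, Pi.inv_apply, ← h, (hw _).sum_conj, Finset.prod_mul_distrib,
      Fintype.card_pi, Nat.cast_prod]

namespace RestrictedDirectProduct

variable {I : Type u} {G : I → Type v} [∀ i, Group (G i)]

theorem finite_ne_one (x : RestrictedDirectProduct G) : {i | x i ≠ 1}.Finite := by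
  have h := x.2
  rw [Filter.eventually_cofinite] at h
  exact h.subset fun i hi h' => hi (Subgroup.mem_bot.1 h')

section Factor

variable [DecidableEq I]

/-- The direct factor of a restricted direct product given by finitely many coordinates. -/
def factor (G : I → Type v) [∀ i, Group (G i)] (F : Finset I) :
    DirectFactor (∀ i : F, G i) (RestrictedDirectProduct G) where
  incl :=
    { toFun := fun k => ⟨fun i => if h : i ∈ F then k ⟨i, h⟩ else 1, by
        rw [Filter.eventually_cofinite]
        refine F.finite_toSet.subset fun i hi => ?_
        by_contra h
        exact hi (by simp [show i ∉ F from h])⟩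
      map_one' := by
        ext i
        change (if h : i ∈ F then (1 : G i) else 1) = 1
        simp
      map_mul' := fun k l => by
        ext i
        change (if h : i ∈ F then k ⟨i, h⟩ * l ⟨i, h⟩ else 1 : G i) =
          (if h : i ∈ F then k ⟨i, h⟩ else 1 : G i) * (if h : i ∈ F then l ⟨i, h⟩ else 1 : G i)
        split_ifs <;> simp }
  proj :=
    { toFun := fun x i => x i
      map_one' := rfl
      map_mul' := fun _ _ => rfl }
  proj_incl k := by
    ext i
    change (if h : (i : I) ∈ F then k ⟨i, h⟩ else 1) = k i
    simp
  conj_incl x k := by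
    ext i
    change x i * (if h : i ∈ F then k ⟨i, h⟩ else 1) * (x i)⁻¹ =
      if h : i ∈ F then x i * k ⟨i, h⟩ * (x i)⁻¹ else 1
    split_ifs <;> simp

theorem factor_incl_apply (F : Finset I) (k : ∀ i : F, G i) (i : I) :
    (factor G F).incl k i = if h : i ∈ F then k ⟨i, h⟩ else 1 := rfl

theorem factor_incl_proj {F : Finset I} {x : RestrictedDirectProduct G}
    (h : x.finite_ne_one.toFinset ⊆ F) : (factor G F).incl ((factor G F).proj x) = x := by
  ext i
  rw [factor_incl_apply]
  split_ifs with hi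
  · rfl
  · by_contra hx
    exact hi (h (by simpa using Ne.symm hx))

end Factor

/-- The product of a family of functions. -/
noncomputable def prodFun (w : ∀ i, G i → ℂ) (x : RestrictedDirectProduct G) : ℂ :=
  ∏ᶠ i, w i (x i)

section ProdFun

variable [∀ i, Fintype (G i)] {w : ∀ i, G i → ℂ} (hw : ∀ i, IsSpherical (w i))
include hw

theorem mulSupport_subset (x : RestrictedDirectProduct G) :
    (Function.mulSupport fun i => w i (x i)) ⊆ {i | x i ≠ 1} := fun i hi h => hi (by
  change w i (x i) = 1
  rw [h, (hw i).map_one])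

theorem prodFun_mul {x y z : RestrictedDirectProduct G}
    (h : ∀ i, w i (z i) = w i (x i) * w i (y i)) :
    prodFun w z = prodFun w x * prodFun w y := by
  unfold prodFun
  rw [← finprod_mul_distrib (x.finite_ne_one.subset (mulSupport_subset hw x))
    (y.finite_ne_one.subset (mulSupport_subset hw y))]
  exact finprod_congr h

theorem norm_prodFun_le (x : RestrictedDirectProduct G) : ‖prodFun w x‖ ≤ 1 := by
  unfold prodFun
  rw [finprod_eq_prod_of_mulSupport_subset (s := x.finite_ne_one.toFinset) _
    (by simpa using mulSupport_subset hw x), norm_prod]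
  exact Finset.prod_le_one (fun _ _ => norm_nonneg _) fun i _ => (hw i).norm_le_one _

variable [DecidableEq I]

theorem prodFun_factor_incl (F : Finset I) (k : ∀ i : F, G i) :
    prodFun w ((factor G F).incl k) = ∏ i : F, w i (k i) := by
  unfold prodFun
  rw [finprod_eq_prod_of_mulSupport_subset (s := F), ← Finset.prod_coe_sort]
  · exact Finset.prod_congr rfl fun i _ => by rw [factor_incl_apply, dif_pos i.2]
  · intro i hi
    by_contra h
    refine mulSupport_subset hw _ hi ?_
    rw [factor_incl_apply, dif_neg (Finset.mem_coe.not.1 h)]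

theorem splits_prodFun (F : Finset I) : (factor G F).Splits (prodFun w) where
  isSpherical := by
    have := IsSpherical.pi fun i : F => hw i
    simp only [← prodFun_factor_incl hw F] at this
    exact this
  apply_eq x := prodFun_mul hw fun i => by
    change w i (x i) = w i (if i ∈ F then x i else 1) * w i (x i * (if i ∈ F then x i else 1)⁻¹)
    split_ifs <;> simp [(hw i).map_one]

/-- The character of `Zℓ¹` given by a family of spherical functions. -/
noncomputable def character : ZL1 (RestrictedDirectProduct G) →ₐ[ℂ] ℂ :=
  ZL1.characterOfPairing (prodFun w) (norm_prodFun_le hw)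
    (by simpa using prodFun_factor_incl hw ∅ 1) fun f hf x => by
      -- Each `x` lies in the factor spanned by its own support, where multiplicativity is already
      -- known.
      rw [← factor_incl_proj (x := x) subset_rfl]
      exact (splits_prodFun hw _).pairing_mul_pointMass _ hf _

end ProdFun

theorem finite_of_hasBoundedApproxIdentity [∀ i, Finite (G i)]
    (h : ∀ J : Ideal (ZL1 (RestrictedDirectProduct G)), J.IsMaximal → J.HasBoundedApproxIdentity) :
    {i : I | ¬ Group.IsNilpotent (G i)}.Finite := by
  classical
  have _ := fun i => Fintype.ofFinite (G i)
  by_contra hinf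
  have hex : ∀ i, ∃ ω : G i → ℂ, IsSpherical ω ∧
      (¬ Group.IsNilpotent (G i) → 301 / 300 * ∑ x, ‖ω x‖ ^ 2 ≤ ∑ x, ‖ω x‖) := fun i => by
    by_cases hi : Group.IsNilpotent (G i)
    · exact ⟨_, IsSpherical.one, fun hn => absurd hi hn⟩
    · obtain ⟨ω, h1, h2⟩ := IsSpherical.exists_gap_of_not_isNilpotent _ (G i) rfl hi
      exact ⟨ω, h1, fun _ => h2⟩
  choose w hw hgap using hex
  have hmax : (RingHom.ker (character hw)).IsMaximal :=
    RingHom.ker_isMaximal_of_surjective _ fun c => ⟨algebraMap ℂ _ c, (character hw).commutes c⟩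
  obtain ⟨M, hM⟩ := h _ hmax
  obtain ⟨n, hn⟩ := pow_unbounded_of_one_lt (M + 2) (by norm_num : (1 : ℝ) < 301 / 300)
  obtain ⟨F, hF, hcard⟩ := Set.Infinite.exists_subset_card_eq hinf n
  have h1 := (splits_prodFun hw F).sum_norm_le_mul_of_approxIdentity (norm_prodFun_le hw)
    (J := RingHom.ker (character hw)) (fun f => RingHom.mem_ker) hM
  simp only [prodFun_factor_incl hw, norm_prod, ← Finset.prod_pow] at h1
  have h2 := Finset.prod_univ_sum (fun i : F => (Finset.univ : Finset (G i))) fun i g => ‖w i g‖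
  have h3 := Finset.prod_univ_sum (fun i : F => (Finset.univ : Finset (G i)))
    fun i g => ‖w i g‖ ^ 2
  rw [Fintype.piFinset_univ] at h2 h3
  rw [← h2, ← h3] at h1
  have h4 : (301 / 300 : ℝ) ^ n * ∏ i : F, ∑ g, ‖w i g‖ ^ 2 ≤ ∏ i : F, ∑ g, ‖w i g‖ := by
    have e : (301 / 300 : ℝ) ^ n = ∏ _i : F, (301 / 300 : ℝ) := by
      rw [Finset.prod_const, Finset.card_univ, Fintype.card_coe, hcard]
    rw [e, ← Finset.prod_mul_distrib]
    exact Finset.prod_le_prod (fun i _ => by positivity) fun i _ => hgap i (hF i.2)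
  have h5 : 0 < ∏ i : F, ∑ g, ‖w i g‖ ^ 2 :=
    Finset.prod_pos fun i _ => one_pos.trans_le (hw i).one_le_sum_sq
  nlinarith

end RestrictedDirectProduct

/-! ### Idempotents of a character as an approximate identity, and part (b) -/

namespace DirectFactor

variable {K : Type*} {Γ : Type u} [Group K] [Group Γ] (D : DirectFactor K Γ)

theorem apply_conj_incl (f : ZL1 Γ) (g x : K) :
    (f : L1 Γ) (D.incl (g * x * g⁻¹)) = (f : L1 Γ) (D.incl x) := by
  rw [D.incl.map_mul, D.incl.map_mul, D.incl.map_inv, L1.conj_apply_of_mem_center f.2]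

variable [Fintype K]

/-- Central functions on the factor act on `conj ω` by scalars; hence `E` times a truncation is a
multiple of `E`. -/
theorem extend_conj_mul_extend {ω : K → ℂ} (hω : IsSpherical ω) {h : K → ℂ}
    (hh : ∀ g x, h (g * x * g⁻¹) = h x) :
    (D.extend fun k => conj (ω k)) * D.extend h =
      (∑ k, h k * ω k) • D.extend fun k => conj (ω k) := by
  have h1 : ∑ k, h k * conj (ω k⁻¹) = ∑ k, h k * ω k :=
    Finset.sum_congr rfl fun k _ => by rw [hω.inv_apply, Complex.conj_conj]
  have h2 := hω.comp_conj.sum_mul_inv_mul hh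
  simp only [h1] at h2
  simp only [extend, Finset.sum_mul_sum, Finset.smul_sum, smul_smul, ← h2, smul_mul_assoc,
    mul_smul_comm, L1.pointMass_mul, ← map_mul, Finset.sum_smul]
  rw [Finset.sum_comm, Finset.sum_comm (s := Finset.univ (α := K)) (t := Finset.univ (α := K))
    (f := fun k l => (h l * conj (ω (l⁻¹ * k))) • L1.pointMass (D.incl k))]
  refine Finset.sum_congr rfl fun l _ => ?_
  rw [← Equiv.sum_comp (Equiv.mulRight l)
    fun k => (h l * conj (ω (l⁻¹ * k))) • L1.pointMass (D.incl k)]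
  refine Finset.sum_congr rfl fun k _ => ?_
  have : ω (l⁻¹ * (k * l)) = ω k := by
    rw [hω.mul_comm_apply, mul_inv_cancel_right]
  rw [Equiv.coe_mulRight, this, mul_comm]

/-- The restriction to a direct factor of a central function, extended by zero. -/
noncomputable def truncate (f : ZL1 Γ) : ZL1 Γ :=
  ⟨D.extend fun k => (f : L1 Γ) (D.incl k), D.extend_mem_center (D.apply_conj_incl f)⟩

/-- The idempotent of `Zℓ¹(Γ)` that a character defines on a finite direct factor. -/
noncomputable def idempotent (φ : ZL1 Γ →ₐ[ℂ] ℂ) : ZL1 Γ :=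
  ((∑ k, ‖φ (D.classMean k)‖ ^ 2 : ℝ) : ℂ)⁻¹ •
    ⟨D.extend fun k => conj (φ (D.classMean k)),
      D.extend_mem_center (D.isSpherical_classMean φ).comp_conj.conj_apply⟩

theorem character_idempotent (φ : ZL1 Γ →ₐ[ℂ] ℂ) : φ (D.idempotent φ) = 1 := by
  have hs := D.isSpherical_classMean φ
  have h1 := φ.toLinearMap.map_smul ((∑ k, ‖φ (D.classMean k)‖ ^ 2 : ℝ) : ℂ)⁻¹
    ⟨D.extend fun k => conj (φ (D.classMean k)), D.extend_mem_center hs.comp_conj.conj_apply⟩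
  refine h1.trans ?_
  rw [AlgHom.toLinearMap_apply, D.character_extend φ hs.comp_conj.conj_apply, smul_eq_mul,
    inv_mul_eq_one₀ (Complex.ofReal_ne_zero.2 (by linarith [hs.one_le_sum_sq]))]
  push_cast
  exact Finset.sum_congr rfl fun k _ => (Complex.conj_mul' _).symm

theorem norm_idempotent_le (φ : ZL1 Γ →ₐ[ℂ] ℂ) {C : ℝ}
    (hC : ∑ k, ‖φ (D.classMean k)‖ ≤ C * ∑ k, ‖φ (D.classMean k)‖ ^ 2) :
    ‖D.idempotent φ‖ ≤ C := by
  have hs := D.isSpherical_classMean φ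
  set S := ∑ k, ‖φ (D.classMean k)‖ ^ 2 with hS
  have hS1 : 1 ≤ S := hs.one_le_sum_sq
  have h1 : ‖(S : ℂ)⁻¹ • D.extend fun k => conj (φ (D.classMean k))‖ ≤ C := by
    rw [norm_smul, norm_inv, Complex.norm_real, Real.norm_of_nonneg (by linarith),
      inv_mul_le_iff₀ (by linarith)]
    refine (D.norm_extend_le _).trans ?_
    simp only [RCLike.norm_conj]
    linarith
  exact h1

theorem idempotent_mul_truncate (φ : ZL1 Γ →ₐ[ℂ] ℂ) (f : ZL1 Γ) :
    D.idempotent φ * D.truncate f = φ (D.truncate f) • D.idempotent φ := by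
  have hs := D.isSpherical_classMean φ
  have h1 := D.extend_conj_mul_extend hs (h := fun k => (f : L1 Γ) (D.incl k))
    (D.apply_conj_incl f)
  have h2 : φ (D.truncate f) = ∑ k, (f : L1 Γ) (D.incl k) * φ (D.classMean k) :=
    D.character_extend φ (h := fun k => (f : L1 Γ) (D.incl k)) (D.apply_conj_incl f)
  refine Subtype.ext ?_
  change ((_ : ℂ)⁻¹ • D.extend fun k => conj (φ (D.classMean k))) *
    (D.extend fun k => (f : L1 Γ) (D.incl k)) = φ (D.truncate f) • ((_ : ℂ)⁻¹ •
      D.extend fun k => conj (φ (D.classMean k)))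
  rw [smul_mul_assoc, h1, h2, smul_comm]

end DirectFactor

namespace RestrictedDirectProduct

variable {I : Type u} {G : I → Type v} [∀ i, Group (G i)]

/-- Truncations are partial sums of the expansion of `f` in point masses, over finite subgroups that
eventually contain any given finite set. -/
theorem tendsto_truncate [DecidableEq I] [∀ i, Fintype (G i)]
    (f : ZL1 (RestrictedDirectProduct G)) :
    Tendsto (fun F : Finset I => (factor G F).truncate f) atTop (𝓝 f) := by
  rw [tendsto_subtype_rng]
  have h1 : Tendsto (fun F : Finset I => Finset.univ.map
      ⟨(factor G F).incl, (factor G F).incl_injective⟩) atTop atTop := by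
    rw [tendsto_atTop]
    intro s
    have : ∀ x ∈ s, ∀ᶠ F : Finset I in atTop, x ∈ Finset.univ.map
        ⟨(factor G F).incl, (factor G F).incl_injective⟩ := fun x _ => by
      filter_upwards [eventually_ge_atTop x.finite_ne_one.toFinset] with F hF
      exact Finset.mem_map.2 ⟨_, Finset.mem_univ _, factor_incl_proj hF⟩
    filter_upwards [(Filter.eventually_all_finset s).2 this] with F hF x hx using hF x hx
  refine ((L1.hasSum_pointMass (f : L1 (RestrictedDirectProduct G))).comp h1).congr fun F => ?_
  simp only [Function.comp_apply, Finset.sum_map]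
  rfl

theorem exists_hasApproxIdentityOfNormLE [∀ i, Finite (G i)]
    (h : {i : I | ¬ (Group.IsNilpotent (G i) ∧ Group.nilpotencyClass (G i) ≤ 2)}.Finite) :
    ∃ M : ℝ, 0 < M ∧ ∀ J : Ideal (ZL1 (RestrictedDirectProduct G)), J.IsMaximal →
      J.HasApproxIdentityOfNormLE M := by
  classical
  have _ := fun i => Fintype.ofFinite (G i)
  let C : ℕ := ∏ i ∈ h.toFinset, Fintype.card (G i)
  -- `C` bounds the idempotents on all finite subproducts, uniformly in the character; the extra `1`
  -- is the norm of the unit.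
  refine ⟨1 + C, by positivity, fun J hJ => ?_⟩
  obtain ⟨φ, hφc, hφ⟩ := ZL1.exists_character J hJ
  have hC : ∀ F : Finset I, ‖(factor G F).idempotent φ‖ ≤ C := fun F => by
    refine (factor G F).norm_idempotent_le φ ?_
    have hs := (factor G F).isSpherical_classMean φ
    refine (hs.sum_norm_le_prod_mul (fun i : F => (i : I) ∈ h.toFinset)
      fun i hi => ?_).trans (mul_le_mul_of_nonneg_right ?_ (by positivity))
    · have hi' : Group.IsNilpotent (G i) ∧ Group.nilpotencyClass (G i) ≤ 2 := by simpa using hi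
      have := hi'.1
      exact commutatorElement_mul_comm_of_nilpotencyClass_le_two hi'.2
    · refine Nat.cast_le.2 ?_
      have e := Finset.prod_map Finset.univ
        (⟨fun i : {i : F // (i : I) ∈ h.toFinset} => ((i : F) : I), fun i j hij =>
          Subtype.ext (Subtype.ext hij)⟩ : _ ↪ I) fun i => Fintype.card (G i)
      refine e.symm.le.trans (Finset.prod_le_prod_of_subset_of_one_le' (fun i hi => ?_)
        fun i _ _ => Fintype.card_pos)
      obtain ⟨j, -, rfl⟩ := Finset.mem_map.1 hi
      exact j.2
  -- The lift only moves the index set into the universe of the algebra.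
  refine ⟨ULift.{v} (Finset I), inferInstance, inferInstance, inferInstance,
    fun F => 1 - (factor G F.down).idempotent φ, fun F => ?_, fun F => ?_, fun f hf => ?_⟩
  · rw [hφ, map_sub, map_one, (factor G F.down).character_idempotent, sub_self]
  · have h1 : ‖(1 : ZL1 (RestrictedDirectProduct G))‖ = 1 := L1.norm_pointMass 1
    have h2 := norm_sub_le 1 ((factor G F.down).idempotent φ)
    linarith [hC F.down]
  · have hdown : Tendsto (ULift.down : ULift.{v} (Finset I) → Finset I) atTop atTop :=
      tendsto_atTop.2 fun F => (eventually_ge_atTop (ULift.up F)).mono fun _ h => h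
    have ht := tendsto_truncate f
    have hφt : Tendsto (fun F : Finset I => φ ((factor G F).truncate f)) atTop (𝓝 0) := by
      rw [← (hφ f).1 hf]
      exact (hφc.tendsto f).comp ht
    have hb : Tendsto (fun F : Finset I => C * ‖f - (factor G F).truncate f‖ +
        ‖φ ((factor G F).truncate f)‖ * C) atTop (𝓝 0) := by
      have h1 := (tendsto_const_nhds (x := f)).sub ht
      have h2 := (h1.norm.const_mul (C : ℝ)).add (hφt.norm.mul_const (C : ℝ))
      simpa using h2
    rw [tendsto_iff_norm_sub_tendsto_zero]
    refine squeeze_zero (fun _ => norm_nonneg _) (fun F => ?_) (hb.comp hdown)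
    set E := (factor G F.down).idempotent φ
    set T := (factor G F.down).truncate f
    -- The error `-E * f` is split at the truncation `T`: the first term is small because `T → f`,
    -- the second because `φ T → φ f = 0`.
    have e : (1 - E) * f - f = -(E * (f - T) + φ T • E) := by
      have hET : E * T = φ T • E := (factor G F.down).idempotent_mul_truncate φ f
      rw [← hET]
      refine Subtype.ext ?_
      change (1 - E.1) * f.1 - f.1 = -(E.1 * (f.1 - T.1) + E.1 * T.1)
      noncomm_ring
    rw [e, norm_neg]
    refine (norm_add_le _ _).trans (add_le_add ?_ ?_)
    · exact (norm_mul_le _ _).trans (mul_le_mul_of_nonneg_right (hC _) (norm_nonneg _))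
    · exact (norm_smul_le _ _).trans (mul_le_mul_of_nonneg_left (hC _) (norm_nonneg _))

end RestrictedDirectProduct

theorem mainTheorem8 {I : Type u} (G : I → Type v) [∀ i, Group (G i)] [∀ i, Finite (G i)] :
    ((∀ J : Ideal (ZL1 (RestrictedDirectProduct G)), J.IsMaximal → J.HasBoundedApproxIdentity) →
      {i : I | ¬ Group.IsNilpotent (G i)}.Finite) ∧
    ({i : I | ¬ (Group.IsNilpotent (G i) ∧ Group.nilpotencyClass (G i) ≤ 2)}.Finite →
      ∃ M : ℝ, 0 < M ∧ ∀ J : Ideal (ZL1 (RestrictedDirectProduct G)), J.IsMaximal →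
        J.HasApproxIdentityOfNormLE M) :=
  ⟨RestrictedDirectProduct.finite_of_hasBoundedApproxIdentity,
    RestrictedDirectProduct.exists_hasApproxIdentityOfNormLE⟩
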